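/- Let $(H,\langle\cdot,\cdot\rangle)$ be a Hilbert space (real or complex), inner product linear in the first variable, and let $\mathbb N=\{1,2,\dots\}$. A sequence $E=(e_n)_{n\in\mathbb N}$ in $H$ is a frame if there are $A,B>0$ with $A\|f\|^2\le\sum_n|\langle f,e_n\rangle|^2\le B\|f\|^2$ for all $f\in H$; its analysis, synthesis and frame operators are $U_Ef=(\langle f,e_n\rangle)_n$, $T_Ec=\sum_n c_ne_n$ and $S_E=T_EU_E$, and its canonical dual is $\widetilde E=(\widetilde e_n)_n=(S_E^{-1}e_n)_n$. A Riesz basis is the image of an orthonormal basis under a bounded bijective operator on $H$. Let $G=(g_n)_{n\in\mathbb N}$ be a Riesz basis of $H$ with canonical dual $(\widetilde g_n)_n$. A frame $E$ is said to be localized with respect to $G$, with decay function $w$, if $\max\{|\langle e_m,g_n\rangle|,|\langle e_m,\widetilde g_n\rangle|\}\le w(|m-n|)$ for all $m,n\in\mathbb N$. It is * $s$-polynomially localized ($s>0$) if this holds with $w(d)=C(1+d)^{-s}$ for some $C>0$; * $\beta$-sub-exponentially localized ($0<\beta<1$) if this holds with $w(d)=Ce^{-\gamma d^\beta}$ for some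 $C,\gamma>0$; * exponentially localized if this holds with $w(d)=Ce^{-\gamma d}$ for some $C,\gamma>0$. A positive continuous function $\mu$ on $\mathbb R$ is a $k$-moderate weight ($k\ge0$ real) if $\mu(t+x)\le C(1+|t|)^k\mu(x)$ for all $t,x\in\mathbb R$ and some $C>0$; it is a $\beta$-sub-exponential weight ($0<\beta<1$) if $\mu(t+x)\le Ce^{\gamma|t|^\beta}\mu(x)$ for all $t,x\in\mathbb R$ and some $C,\gamma>0$. For $p\in[1,\infty)$ put $\|a\|_{p,\mu}=\big(\sum_n|a_n|^p\mu(n)^p\big)^{1/p}$ and $\ell^p_\mu=\{a:\|a\|_{p,\mu}<\infty\}$, and let $$H_G^{\ell^p_\mu}=\{f\in H:(\langle f,\widetilde g_n\rangle)_n\in\ell^p_\mu\},\qquad \|f\|_{H_G^{\ell^p_\mu}}=\|(\langle f,\widetilde g_n\rangle)_n\|_{p,\mu}.$$ **Theorem.** Let $G$ be a Riesz basis of $H$, let $E$ be a frame for $H$, and let $\mu$ be a weight with $\mu(n)\ge1$ for all $n\in\mathbb N$. Assume that one of the following holds: * (a) $E$ is $\beta$-sub-exponentially localized with respect to $G$,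 and $\mu$ is a $\beta_\mu$-sub-exponential weight with $\beta_\mu<\beta$; * (b) $E$ is exponentially localized with respect to $G$, and $\mu$ is a $\beta_\mu$-sub-exponential weight for some $\beta_\mu\in(0,1)$; * (c) $E$ is $(k+1+\varepsilon)$-polynomially localized with respect to $G$ for some $\varepsilon>0$, and $\mu$ is a $k$-moderate weight. Then the following hold for every $p\in[1,\infty)$. 1. $U_E$ maps $H_G^{\ell^p_\mu}$ boundedly into $\ell^p_\mu$. 2. There is a constant $C$ such that for every $c\in\ell^p_\mu\cap\ell^2$ (which is all of $\ell^p_\mu$ whenever $\ell^p_\mu\subseteq\ell^2$, in particular for $p\le2$) the series $T_Ec=\sum_nc_ne_n$ converges unconditionally in $H$, $T_Ec\in H_G^{\ell^p_\mu}$, and $\|T_Ec\|_{H_G^{\ell^p_\mu}}\le C\|c\|_{p,\mu}$. 3. $S_E$ maps $H_G^{\ell^p_\mu}$ bijectively onto itself, it is bounded there together with its inverse, and for every $f\in H_G^{\ell^p_\mu}$ the series $S_Ef=\sum_n\langle f,e_n\rangle e_n$ converges unconditionally in $H_G^{\ell^p_\mu}$. 4. $\widetilde E$ is a frame with the same type of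 localization with respect to $G$ as $E$: it is $\beta$-sub-exponentially localized in case (a), exponentially localized in case (b), and $(k+1+\varepsilon)$-polynomially localized, with the same $k+1+\varepsilon$, in case (c). 5. For every $f\in H_G^{\ell^p_\mu}$, $f=\sum_n\langle f,e_n\rangle\widetilde e_n=\sum_n\langle f,\widetilde e_n\rangle e_n$ with unconditional convergence in $H_G^{\ell^p_\mu}$. 6. On $H_G^{\ell^p_\mu}$ the norms $\|f\|_{H_G^{\ell^p_\mu}}$, $\|(\langle f,e_n\rangle)_n\|_{p,\mu}$ and $\|(\langle f,\widetilde e_n\rangle)_n\|_{p,\mu}$ are equivalent. -/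

import Mathlib

open scoped ENNReal Topology

noncomputable section

namespace LocFrame

/-! Sequences are indexed by the positive integers `ℕ+`.  The pairing `⟨f, g⟩` that is linear in `f`
is `inner 𝕜 g f` in Mathlib. -/

section Frames

variable (𝕜 : Type*) {H : Type*} [RCLike 𝕜] [NormedAddCommGroup H] [InnerProductSpace 𝕜 H]

/-- The analysis operator `f ↦ (⟨f, eₙ⟩)ₙ`. -/
def analysis (e : ℕ+ → H) (f : H) : ℕ+ → 𝕜 := fun n => inner 𝕜 (e n) f

variable {𝕜} in
/-- The synthesis operator `c ↦ ∑ₙ cₙ eₙ`, the series being taken in `H`. -/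
def synthesis (e : ℕ+ → H) (c : ℕ+ → 𝕜) : H := ∑' n, c n • e n

/-- The frame operator `f ↦ ∑ₙ ⟨f, eₙ⟩ eₙ`. -/
def frameOp (e : ℕ+ → H) (f : H) : H := synthesis e (analysis 𝕜 e f)

/-- `A ‖f‖² ≤ ∑ₙ |⟨f, eₙ⟩|² ≤ B ‖f‖²` for all `f`, with `A, B > 0`. -/
def IsFrame (e : ℕ+ → H) : Prop :=
  ∃ A B : ℝ, 0 < A ∧ 0 < B ∧ ∀ f : H,
    Summable (fun n => ‖analysis 𝕜 e f n‖ ^ 2) ∧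
    A * ‖f‖ ^ 2 ≤ ∑' n, ‖analysis 𝕜 e f n‖ ^ 2 ∧
    ∑' n, ‖analysis 𝕜 e f n‖ ^ 2 ≤ B * ‖f‖ ^ 2

/-- The image of an orthonormal basis under a bounded bijective operator. -/
def IsRieszBasis (g : ℕ+ → H) : Prop :=
  ∃ (b : HilbertBasis ℕ+ 𝕜 H) (T : H →L[𝕜] H), Function.Bijective T ∧ ∀ n, g n = T (b n)

/-- The canonical dual `S⁻¹ eₙ`, where `S` is the frame operator of `e`.
For a frame `S` is a bijection of `H`, see `IsFrame.frameOp_bijective` below. -/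
def canonicalDual (e : ℕ+ → H) : ℕ+ → H := fun n => Function.invFun (frameOp 𝕜 e) (e n)

end Frames

section Sanity

variable {𝕜 H : Type*} [RCLike 𝕜] [NormedAddCommGroup H] [InnerProductSpace 𝕜 H] [CompleteSpace H]

/-- For a frame, the series of the frame operator converges unconditionally in `H`, and the frame
operator is a bounded bijective operator on `H`. -/
theorem IsFrame.exists_clm {e : ℕ+ → H} (he : IsFrame 𝕜 e) :
    ∃ S : H →L[𝕜] H, Function.Bijective S ∧
      ∀ f, HasSum (fun n => analysis 𝕜 e f n • e n) (S f) := by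
  obtain ⟨A, B, hA, hB, h⟩ := he
  have hmem : ∀ f : H, Memℓp (analysis 𝕜 e f) 2 := fun f =>
    memℓp_gen (by simpa using (h f).1)
  have hnorm : ∀ f : H, ‖(⟨analysis 𝕜 e f, hmem f⟩ : lp (fun _ : ℕ+ => 𝕜) 2)‖ ^ 2
      = ∑' n, ‖analysis 𝕜 e f n‖ ^ 2 := by
    intro f
    have := lp.norm_rpow_eq_tsum (p := 2) (by norm_num)
      (⟨analysis 𝕜 e f, hmem f⟩ : lp (fun _ : ℕ+ => 𝕜) 2)
    simpa using this
  let U₀ : H →ₗ[𝕜] lp (fun _ : ℕ+ => 𝕜) 2 :=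
    { toFun := fun f => ⟨analysis 𝕜 e f, hmem f⟩
      map_add' := fun x y => by
        ext n; exact inner_add_right _ _ _
      map_smul' := fun c x => by
        ext n; exact inner_smul_right _ _ _ }
  let U : H →L[𝕜] lp (fun _ : ℕ+ => 𝕜) 2 := U₀.mkContinuous (Real.sqrt B) (fun f => by
    have h1 : ‖U₀ f‖ ^ 2 ≤ B * ‖f‖ ^ 2 := (hnorm f).trans_le (h f).2.2
    have h2 : ‖U₀ f‖ ^ 2 ≤ (Real.sqrt B * ‖f‖) ^ 2 := by
      rw [mul_pow, Real.sq_sqrt hB.le]; exact h1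
    exact le_of_sq_le_sq h2 (by positivity))
  have hU : ∀ f n, U f n = inner 𝕜 (e n) f := fun f n => rfl
  have hU2 : ∀ f, ‖U f‖ ^ 2 = ∑' n, ‖analysis 𝕜 e f n‖ ^ 2 := hnorm
  have hadj : ∀ n (c : 𝕜), U.adjoint (lp.single 2 n c) = c • e n := by
    intro n c
    refine ext_inner_right 𝕜 fun f => ?_
    rw [ContinuousLinearMap.adjoint_inner_left, lp.inner_single_left, hU, inner_smul_left]
    simp [mul_comm]
  refine ⟨U.adjoint ∘L U, ?_, fun f => ?_⟩
  · have hu : IsUnit (U.adjoint ∘L U) := by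
      refine ContinuousLinearMap.isUnit_of_forall_le_norm_inner_map _
        (c := A.toNNReal) (Real.toNNReal_pos.2 hA) fun f => ?_
      have : inner 𝕜 ((U.adjoint ∘L U) f) f = ((‖U f‖ ^ 2 : ℝ) : 𝕜) := by
        rw [ContinuousLinearMap.comp_apply, ContinuousLinearMap.adjoint_inner_left,
          inner_self_eq_norm_sq_to_K]
        push_cast; rfl
      rw [this, RCLike.norm_ofReal, abs_of_nonneg (by positivity), hU2]
      have := (h f).2.1
      rw [Real.coe_toNNReal A hA.le]
      linarith
    exact (ContinuousLinearMap.isUnit_iff_bijective).1 hu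
  · have h1 := lp.hasSum_single (p := 2) (by norm_num) (U f)
    have h2 := h1.mapL U.adjoint
    simpa [hadj, hU, analysis] using h2

theorem IsFrame.frameOp_bijective {e : ℕ+ → H} (he : IsFrame 𝕜 e) :
    Function.Bijective (frameOp 𝕜 e) := by
  obtain ⟨S, hS, hs⟩ := he.exists_clm
  have : frameOp 𝕜 e = S := funext fun f => (hs f).tsum_eq
  rwa [this]

/-- The canonical dual satisfies `S ẽₙ = eₙ`. -/
theorem IsFrame.frameOp_canonicalDual {e : ℕ+ → H} (he : IsFrame 𝕜 e) (n : ℕ+) :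
    frameOp 𝕜 e (canonicalDual 𝕜 e n) = e n :=
  Function.invFun_eq (he.frameOp_bijective.2 (e n))

end Sanity

section Localization

variable (𝕜 : Type*) {H : Type*} [RCLike 𝕜] [NormedAddCommGroup H] [InnerProductSpace 𝕜 H]

/-- The three types of localization: polynomial with decay `s`, `β`-sub-exponential, exponential. -/
inductive LocType where
  | poly (s : ℝ)
  | subexp (β : ℝ)
  | exp

/-- `max (|⟨eₘ, gₙ⟩|, |⟨eₘ, g̃ₙ⟩|) ≤ w (|m - n|)` for all `m, n`. -/
def LocBound (g e : ℕ+ → H) (w : ℝ → ℝ) : Prop :=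
  ∀ m n : ℕ+, max ‖inner 𝕜 (g n) (e m)‖ ‖inner 𝕜 (canonicalDual 𝕜 g n) (e m)‖
    ≤ w |(m : ℝ) - (n : ℝ)|

/-- `e` is localized of the given type with respect to the Riesz basis `g`. -/
def IsLocalized (g e : ℕ+ → H) : LocType → Prop
  | .poly s => 0 < s ∧ ∃ C > 0, LocBound 𝕜 g e (fun d => C * (1 + d) ^ (-s))
  | .subexp β => 0 < β ∧ β < 1 ∧
      ∃ γ > 0, ∃ C > 0, LocBound 𝕜 g e (fun d => C * Real.exp (-γ * d ^ β))
  | .exp => ∃ γ > 0, ∃ C > 0, LocBound 𝕜 g e (fun d => C * Real.exp (-γ * d))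

end Localization

section Weights

/-- `μ` is a `k`-moderate weight. -/
def IsModerateWeight (k : ℝ) (μ : ℝ → ℝ) : Prop :=
  0 ≤ k ∧ Continuous μ ∧ (∀ x, 0 < μ x) ∧
    ∃ C > 0, ∀ t x : ℝ, μ (t + x) ≤ C * (1 + |t|) ^ k * μ x

/-- `μ` is a `β`-sub-exponential weight. -/
def IsSubexpWeight (β : ℝ) (μ : ℝ → ℝ) : Prop :=
  0 < β ∧ β < 1 ∧ Continuous μ ∧ (∀ x, 0 < μ x) ∧
    ∃ C > 0, ∃ γ > 0, ∀ t x : ℝ, μ (t + x) ≤ C * Real.exp (γ * |t| ^ β) * μ x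

/-- The weights that are admitted for each type of localization. -/
def IsAdmissibleWeight (μ : ℝ → ℝ) : LocType → Prop
  | .poly s => ∃ k ε : ℝ, 0 < ε ∧ s = k + 1 + ε ∧ IsModerateWeight k μ
  | .subexp β => ∃ βμ : ℝ, βμ < β ∧ IsSubexpWeight βμ μ
  | .exp => ∃ βμ : ℝ, IsSubexpWeight βμ μ

end Weights

section Spaces

variable (𝕜 : Type*) {H : Type*} [RCLike 𝕜] [NormedAddCommGroup H] [InnerProductSpace 𝕜 H]

variable {𝕜} in
/-- The norm `(∑ₙ |aₙ|^p μ(n)^p)^{1/p}`, with values in `[0, ∞]`. -/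
def wNorm (p : ℝ) (μ : ℝ → ℝ) (a : ℕ+ → 𝕜) : ℝ≥0∞ :=
  (∑' n : ℕ+, ENNReal.ofReal (‖a n‖ ^ p * μ (n : ℝ) ^ p)) ^ (1 / p)

/-- The weighted sequence space `ℓ^p_μ`. -/
def weightedLp (p : ℝ) (μ : ℝ → ℝ) : Set (ℕ+ → 𝕜) := {a | wNorm p μ a < ∞}

/-- The unweighted space `ℓ²`. -/
def ellTwo : Set (ℕ+ → 𝕜) := weightedLp 𝕜 2 (fun _ => 1)

/-- The norm of `f` in `H_G^{ℓ^p_μ}`, i.e. the `ℓ^p_μ`-norm of `(⟨f, g̃ₙ⟩)ₙ`. -/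
def coNorm (p : ℝ) (μ : ℝ → ℝ) (g : ℕ+ → H) (f : H) : ℝ≥0∞ :=
  wNorm p μ (analysis 𝕜 (canonicalDual 𝕜 g) f)

/-- The space `H_G^{ℓ^p_μ} = {f ∈ H : (⟨f, g̃ₙ⟩)ₙ ∈ ℓ^p_μ}`. -/
def coSpace (p : ℝ) (μ : ℝ → ℝ) (g : ℕ+ → H) : Set H :=
  {f | analysis 𝕜 (canonicalDual 𝕜 g) f ∈ weightedLp 𝕜 p μ}

/-- The series `∑ₙ xₙ` of elements of `H_G^{ℓ^p_μ}` converges unconditionally to `y` in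
`H_G^{ℓ^p_μ}`: the finite partial sums converge to `y` along the directed set of all finite sets of
indices. -/
def HasUncondSum (p : ℝ) (μ : ℝ → ℝ) (g : ℕ+ → H) (x : ℕ+ → H) (y : H) : Prop :=
  (∀ n, x n ∈ coSpace 𝕜 p μ g) ∧ y ∈ coSpace 𝕜 p μ g ∧
    Filter.Tendsto (fun F : Finset ℕ+ => coNorm 𝕜 p μ g (y - ∑ n ∈ F, x n)) Filter.atTop (𝓝 0)

end Spaces

end LocFrame

end

noncomputable section

namespace LocFrame

/-- The decay function `d ↦ exp (-c d^β) (1 + d)^(-s)`. -/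
def decay (β c s d : ℝ) : ℝ := Real.exp (-c * d ^ β) * (1 + d) ^ (-s)

/-- The sum of `(1 + |d|)^(-s)` over the integers. -/
def decaySum (s : ℝ) : ℝ := ∑' d : ℤ, (1 + |(d : ℝ)|) ^ (-s)

section Decay

variable {β c s σ : ℝ}

lemma decay_pos {d : ℝ} (hd : 0 ≤ d) : 0 < decay β c s d := by
  unfold decay; positivity

lemma decay_zero (hβ : 0 < β) : decay β c s 0 = 1 := by
  simp [decay, Real.zero_rpow hβ.ne']

lemma decay_le_of_le {c' d : ℝ} (hd : 0 ≤ d) (h : c' ≤ c) : decay β c s d ≤ decay β c' s d := by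
  unfold decay
  have : 0 ≤ d ^ β := by positivity
  gcongr

lemma decay_le_rpow {d : ℝ} (hd : 0 ≤ d) (hc : 0 ≤ c) : decay β c s d ≤ (1 + d) ^ (-s) := by
  have := decay_le_of_le (β := β) (s := s) hd hc
  simpa [decay] using this

lemma summable_one_add_abs_rpow (hs : 1 < s) : Summable fun d : ℤ => (1 + |(d : ℝ)|) ^ (-s) := by
  have h : Summable fun n : ℕ => (1 + (n : ℝ)) ^ (-s) := by
    have := (summable_nat_add_iff 1).2 (Real.summable_nat_rpow.2 (by linarith : -s < -1))
    simpa [add_comm] using this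
  exact Summable.of_nat_of_neg (by simpa using h) (by simpa using h)

lemma decaySum_pos (hs : 1 < s) : 0 < decaySum s :=
  (summable_one_add_abs_rpow hs).tsum_pos (fun d => by positivity) 0 (by positivity)

lemma injective_int_sub (m : ℕ+) : Function.Injective fun k : ℕ+ => ((m : ℕ) : ℤ) - ((k : ℕ) : ℤ) := by
  intro a b h
  have : ((a : ℕ) : ℤ) = ((b : ℕ) : ℤ) := by simpa using h
  exact_mod_cast this

lemma summable_dist_rpow (hs : 1 < s) (m : ℕ+) :
    Summable fun k : ℕ+ => (1 + |(m : ℝ) - (k : ℝ)|) ^ (-s) := by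
  have := (summable_one_add_abs_rpow hs).comp_injective (injective_int_sub m)
  simpa [Function.comp_def] using this

lemma tsum_dist_rpow_le (hs : 1 < s) (m : ℕ+) :
    ∑' k : ℕ+, (1 + |(m : ℝ) - (k : ℝ)|) ^ (-s) ≤ decaySum s := by
  have := tsum_comp_le_tsum_of_inj (summable_one_add_abs_rpow hs) (fun d => by positivity)
    (injective_int_sub m)
  simpa [Function.comp_def, decaySum] using this

lemma rpow_neg_le_of_half_le {x d : ℝ} (hs : 0 ≤ s) (hd : 0 ≤ d) (h : d ≤ 2 * x) :
    (1 + x) ^ (-s) ≤ 2 ^ s * (1 + d) ^ (-s) := by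
  have hx : 0 ≤ x := by linarith
  have h1 : ((1 + d) / 2) ^ s ≤ (1 + x) ^ s :=
    Real.rpow_le_rpow (by positivity) (by linarith) hs
  rw [Real.div_rpow (by positivity) (by norm_num)] at h1
  rw [Real.rpow_neg (by positivity), Real.rpow_neg (by positivity), ← div_eq_mul_inv,
    ← inv_div]
  exact inv_anti₀ (by positivity) h1

lemma exp_decay_mul_le {x y d : ℝ} (hβ : 0 < β) (hβ1 : β ≤ 1) (hc : 0 ≤ c) (hx : 0 ≤ x) (hy : 0 ≤ y)
    (hd : 0 ≤ d) (h : d ≤ x + y) :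
    Real.exp (-c * x ^ β) * Real.exp (-c * y ^ β) ≤ Real.exp (-c * d ^ β) := by
  rw [← Real.exp_add]
  have h1 : d ^ β ≤ x ^ β + y ^ β :=
    (Real.rpow_le_rpow hd h hβ.le).trans (Real.rpow_add_le_add_rpow hx hy hβ.le hβ1)
  apply Real.exp_le_exp.2
  nlinarith

/-- A product of two decaying quantities decays: the larger of the two distances carries the decay,
the other factor is summable. -/
lemma mul_le_decay {x y d X Y a a' b b' : ℝ} (hβ : 0 < β) (hβ1 : β ≤ 1) (hc : 0 ≤ c) (hs : 0 ≤ s)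
    (hx : 0 ≤ x) (hy : 0 ≤ y) (hd : 0 ≤ d) (h : d ≤ x + y) (hX : 0 ≤ X) (hY : 0 ≤ Y)
    (ha : X ≤ a * decay β c s x) (ha' : X ≤ a' * decay β c σ x)
    (hb : Y ≤ b * decay β c s y) (hb' : Y ≤ b' * decay β c σ y) :
    X * Y ≤ 2 ^ s * decay β c s d * (a * b' * (1 + y) ^ (-σ) + a' * b * (1 + x) ^ (-σ)) := by
  have pa : 0 ≤ a := nonneg_of_mul_nonneg_left (hX.trans ha) (decay_pos hx)
  have pa' : 0 ≤ a' := nonneg_of_mul_nonneg_left (hX.trans ha') (decay_pos hx)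
  have pb : 0 ≤ b := nonneg_of_mul_nonneg_left (hY.trans hb) (decay_pos hy)
  have pb' : 0 ≤ b' := nonneg_of_mul_nonneg_left (hY.trans hb') (decay_pos hy)
  have hE := exp_decay_mul_le hβ hβ1 hc hx hy hd h
  have key : ∀ {x y u v U V : ℝ}, 0 ≤ x → 0 ≤ y → 0 ≤ u → 0 ≤ v → 0 ≤ U → 0 ≤ V →
      U ≤ u * decay β c s x → V ≤ v * decay β c σ y → d ≤ 2 * x →
      Real.exp (-c * x ^ β) * Real.exp (-c * y ^ β) ≤ Real.exp (-c * d ^ β) →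
      U * V ≤ 2 ^ s * decay β c s d * (u * v * (1 + y) ^ (-σ)) := by
    intro x y u v U V hx hy hu hv hU hV h1 h2 h3 hE
    calc U * V ≤ (u * decay β c s x) * (v * decay β c σ y) :=
          mul_le_mul h1 h2 hV (mul_nonneg hu (decay_pos hx).le)
      _ = u * v * (1 + y) ^ (-σ) *
          ((Real.exp (-c * x ^ β) * Real.exp (-c * y ^ β)) * (1 + x) ^ (-s)) := by
          unfold decay; ring
      _ ≤ u * v * (1 + y) ^ (-σ) * (Real.exp (-c * d ^ β) * (2 ^ s * (1 + d) ^ (-s))) := by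
          gcongr
          exact rpow_neg_le_of_half_le hs hd h3
      _ = _ := by unfold decay; ring
  have hD : 0 ≤ 2 ^ s * decay β c s d := mul_nonneg (by positivity) (decay_pos hd).le
  rcases le_total y x with hxy | hxy
  · refine (key hx hy pa pb' hX hY ha hb' (by linarith) hE).trans ?_
    refine mul_le_mul_of_nonneg_left (le_add_of_nonneg_right (by positivity)) hD
  · rw [mul_comm X Y]
    refine (key hy hx pb pa' hY hX hb ha' (by linarith) (by rwa [mul_comm])).trans ?_
    refine mul_le_mul_of_nonneg_left ?_ hD
    rw [mul_comm b a']
    exact le_add_of_nonneg_left (by positivity)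

/-- The entries of a product of two matrices with off-diagonal decay. -/
lemma norm_le_decay_of_hasSum {𝕜 : Type*} [RCLike 𝕜] {X Y : ℕ+ → 𝕜} {z : 𝕜} {m n : ℕ+}
    {a a' b b' : ℝ} (hβ : 0 < β) (hβ1 : β ≤ 1) (hc : 0 ≤ c) (hs : 0 ≤ s) (hσ : 1 < σ)
    (hz : HasSum (fun k => X k * Y k) z)
    (ha : ∀ k, ‖X k‖ ≤ a * decay β c s |(m : ℝ) - k|)
    (ha' : ∀ k, ‖X k‖ ≤ a' * decay β c σ |(m : ℝ) - k|)
    (hb : ∀ k, ‖Y k‖ ≤ b * decay β c s |(k : ℝ) - n|)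
    (hb' : ∀ k, ‖Y k‖ ≤ b' * decay β c σ |(k : ℝ) - n|) :
    ‖z‖ ≤ 2 ^ s * decaySum σ * (a * b' + a' * b) * decay β c s |(m : ℝ) - n| := by
  have pa : 0 ≤ a :=
    nonneg_of_mul_nonneg_left ((norm_nonneg _).trans (ha 1)) (decay_pos (abs_nonneg _))
  have pa' : 0 ≤ a' :=
    nonneg_of_mul_nonneg_left ((norm_nonneg _).trans (ha' 1)) (decay_pos (abs_nonneg _))
  have pb : 0 ≤ b :=
    nonneg_of_mul_nonneg_left ((norm_nonneg _).trans (hb 1)) (decay_pos (abs_nonneg _))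
  have pb' : 0 ≤ b' :=
    nonneg_of_mul_nonneg_left ((norm_nonneg _).trans (hb' 1)) (decay_pos (abs_nonneg _))
  have hD : 0 ≤ 2 ^ s * decay β c s |(m : ℝ) - n| :=
    mul_nonneg (by positivity) (decay_pos (abs_nonneg _)).le
  have s1 : Summable fun k : ℕ+ => a * b' * (1 + |(k : ℝ) - n|) ^ (-σ) := by
    simpa only [abs_sub_comm] using (summable_dist_rpow hσ n).mul_left (a * b')
  have s2 : Summable fun k : ℕ+ => a' * b * (1 + |(m : ℝ) - k|) ^ (-σ) :=
    (summable_dist_rpow hσ m).mul_left (a' * b)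
  have t1 : ∑' k : ℕ+, a * b' * (1 + |(k : ℝ) - n|) ^ (-σ) ≤ a * b' * decaySum σ := by
    rw [tsum_mul_left]
    refine mul_le_mul_of_nonneg_left ?_ (by positivity)
    simpa only [abs_sub_comm] using tsum_dist_rpow_le hσ n
  have t2 : ∑' k : ℕ+, a' * b * (1 + |(m : ℝ) - k|) ^ (-σ) ≤ a' * b * decaySum σ := by
    rw [tsum_mul_left]
    exact mul_le_mul_of_nonneg_left (tsum_dist_rpow_le hσ m) (by positivity)
  have hS := (s1.hasSum.add s2.hasSum).mul_left (2 ^ s * decay β c s |(m : ℝ) - n|)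
  refine (hz.norm_le_of_bounded hS fun k => ?_).trans ?_
  · rw [norm_mul]
    exact mul_le_decay hβ hβ1 hc hs (abs_nonneg _) (abs_nonneg _) (abs_nonneg _)
      (abs_sub_le _ _ _) (norm_nonneg _) (norm_nonneg _) (ha k) (ha' k) (hb k) (hb' k)
  · refine (mul_le_mul_of_nonneg_left (add_le_add t1 t2) hD).trans_eq ?_
    ring

end Decay

section Matrices

variable {𝕜 H : Type*} [RCLike 𝕜] [NormedAddCommGroup H] [InnerProductSpace 𝕜 H]

/-- The matrix of the operator `A` in the orthonormal basis `b` has off-diagonal decay. -/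
def DecayLE (b : HilbertBasis ℕ+ 𝕜 H) (A : H →L[𝕜] H) (β c s C : ℝ) : Prop :=
  ∀ m n : ℕ+, ‖inner 𝕜 (b m) (A (b n))‖ ≤ C * decay β c s |(m : ℝ) - n|

lemma hasSum_inner_comp [CompleteSpace H] (b : HilbertBasis ℕ+ 𝕜 H) (A : H →L[𝕜] H) (x y : H) :
    HasSum (fun k => inner 𝕜 x (A (b k)) * inner 𝕜 (b k) y) (inner 𝕜 x (A y)) := by
  have := b.hasSum_inner_mul_inner (A.adjoint x) y
  simpa only [ContinuousLinearMap.adjoint_inner_left] using this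

variable {b : HilbertBasis ℕ+ 𝕜 H} {A B : H →L[𝕜] H} {β c s C D : ℝ}

lemma DecayLE.nonneg (h : DecayLE b A β c s C) : 0 ≤ C :=
  nonneg_of_mul_nonneg_left ((norm_nonneg _).trans (h 1 1)) (decay_pos (abs_nonneg _))

lemma DecayLE.mono (h : DecayLE b A β c s C) (hCD : C ≤ D) : DecayLE b A β c s D := fun m n =>
  (h m n).trans (mul_le_mul_of_nonneg_right hCD (decay_pos (abs_nonneg _)).le)

lemma DecayLE.mono_rate {c' : ℝ} (h : DecayLE b A β c s C) (hc : c' ≤ c) :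
    DecayLE b A β c' s C := fun m n =>
  (h m n).trans (mul_le_mul_of_nonneg_left (decay_le_of_le (abs_nonneg _) hc) h.nonneg)

lemma decayLE_one (hβ : 0 < β) : DecayLE b 1 β c s 1 := by
  intro m n
  rw [one_apply_eq_self, orthonormal_iff_ite.1 b.orthonormal m n]
  split_ifs with h
  · subst h
    simp [decay_zero hβ]
  · simpa using (decay_pos (abs_nonneg _)).le

lemma decayLE_zero : DecayLE b 0 β c s 0 := by
  intro m n
  simp

lemma DecayLE.add (hA : DecayLE b A β c s C) (hB : DecayLE b B β c s D) :
    DecayLE b (A + B) β c s (C + D) := by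
  intro m n
  rw [add_apply, inner_add_right, add_mul]
  exact (norm_add_le _ _).trans (add_le_add (hA m n) (hB m n))

lemma DecayLE.smul (a : 𝕜) (hA : DecayLE b A β c s C) : DecayLE b (a • A) β c s (‖a‖ * C) := by
  intro m n
  rw [smul_apply, inner_smul_right, norm_mul, mul_assoc]
  exact mul_le_mul_of_nonneg_left (hA m n) (norm_nonneg _)

lemma norm_entry_le (m n : ℕ+) : ‖inner 𝕜 (b m) (A (b n))‖ ≤ ‖A‖ := by
  refine (norm_inner_le_norm _ _).trans ?_
  have h1 := b.orthonormal.1 m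
  have h2 := A.le_opNorm (b n)
  rw [b.orthonormal.1 n, mul_one] at h2
  rwa [h1, one_mul]

lemma decay_one_zero (d : ℝ) : decay 1 0 s d = (1 + d) ^ (-s) := by simp [decay]

/-- Interpolation between a small polynomial bound and a sub-exponential bound. -/
lemma DecayLE.interpolate {ε : ℝ} (hε : 0 < ε) (h0 : DecayLE b A 1 0 s ε)
    (h1 : DecayLE b A β c s C) :
    ∃ θ : ℝ, 0 < θ ∧ θ ≤ 1 ∧ DecayLE b A β (θ * c) s (2 * ε) := by
  set C' : ℝ := max C ε
  have hC' : 0 < C' := lt_max_of_lt_right hε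
  have hlim : Filter.Tendsto (fun θ : ℝ => ε ^ (1 - θ) * C' ^ θ) (𝓝[>] 0) (𝓝 ε) := by
    have : ContinuousAt (fun θ : ℝ => ε ^ (1 - θ) * C' ^ θ) 0 := by
      apply ContinuousAt.mul
      · exact ContinuousAt.rpow continuousAt_const (by fun_prop) (Or.inl hε.ne')
      · exact ContinuousAt.rpow continuousAt_const (by fun_prop) (Or.inl hC'.ne')
    have h := this.tendsto
    simp only [sub_zero, Real.rpow_one, Real.rpow_zero, mul_one] at h
    exact h.mono_left nhdsWithin_le_nhds
  obtain ⟨θ, hθ, hθ0, hθ1⟩ := (((tendsto_order.1 hlim).2 (2 * ε) (by linarith)).and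
    (Ioc_mem_nhdsGT (zero_lt_one' ℝ))).exists
  refine ⟨θ, hθ0, hθ1, fun m n => ?_⟩
  set x := ‖inner 𝕜 (b m) (A (b n))‖
  have hx : 0 ≤ x := norm_nonneg _
  have e0 := h0 m n
  have e1 := (h1.mono (le_max_left C ε)) m n
  set d := |(m : ℝ) - n|
  have hd : 0 ≤ 1 + d := by positivity
  have hd' : 0 < 1 + d := by positivity
  rw [decay_one_zero] at e0
  calc x = x ^ ((1 - θ) + θ) := by simp
    _ = x ^ (1 - θ) * x ^ θ := Real.rpow_add_of_nonneg hx (by linarith) hθ0.le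
    _ ≤ (ε * (1 + d) ^ (-s)) ^ (1 - θ) * (C' * decay β c s d) ^ θ := by
        gcongr
    _ = (ε ^ (1 - θ) * C' ^ θ) * (Real.exp (-c * d ^ β * θ) *
          ((1 + d) ^ (-s * (1 - θ)) * (1 + d) ^ (-s * θ))) := by
        unfold decay
        rw [Real.mul_rpow (by positivity) (by positivity), Real.mul_rpow (by positivity)
          (by positivity), Real.mul_rpow (by positivity) (by positivity), ← Real.exp_mul,
          ← Real.rpow_mul hd, ← Real.rpow_mul hd]
        ring
    _ = (ε ^ (1 - θ) * C' ^ θ) * decay β (θ * c) s d := by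
        unfold decay
        rw [← Real.rpow_add hd']
        ring_nf
    _ ≤ 2 * ε * decay β (θ * c) s d :=
        mul_le_mul_of_nonneg_right hθ.le (decay_pos (abs_nonneg _)).le

variable [CompleteSpace H]

lemma DecayLE.mul (hβ : 0 < β) (hβ1 : β ≤ 1) (hc : 0 ≤ c) (hs : 1 < s)
    (hA : DecayLE b A β c s C) (hB : DecayLE b B β c s D) :
    DecayLE b (A * B) β c s (2 ^ s * decaySum s * 2 * (C * D)) := by
  intro m n
  refine (norm_le_decay_of_hasSum hβ hβ1 hc (by linarith) hs
    (hasSum_inner_comp b A (b m) (B (b n))) (hA m) (hA m) (fun k => hB k n)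
    (fun k => hB k n)).trans_eq ?_
  ring

lemma exists_decayLE_pow (hβ : 0 < β) (hβ1 : β ≤ 1) (hc : 0 ≤ c) (hs : 1 < s)
    (hA : DecayLE b A β c s C) (j : ℕ) : ∃ D, DecayLE b (A ^ j) β c s D := by
  induction j with
  | zero => exact ⟨1, by simpa using decayLE_one hβ⟩
  | succ j ih =>
    obtain ⟨D, hD⟩ := ih
    exact ⟨_, by rw [pow_succ]; exact hD.mul hβ hβ1 hc hs hA⟩

lemma exists_decayLE_geom_sum (hβ : 0 < β) (hβ1 : β ≤ 1) (hc : 0 ≤ c) (hs : 1 < s)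
    (hA : DecayLE b A β c s C) (J : ℕ) :
    ∃ D, DecayLE b (∑ l ∈ Finset.range J, A ^ l) β c s D := by
  induction J with
  | zero => exact ⟨0, by simpa using decayLE_zero⟩
  | succ J ih =>
    obtain ⟨D, hD⟩ := ih
    obtain ⟨D', hD'⟩ := exists_decayLE_pow hβ hβ1 hc hs hA J
    exact ⟨_, by rw [Finset.sum_range_succ]; exact hD.add hD'⟩

/-- Squaring a matrix with polynomial decay gains from its operator norm. -/
lemma DecayLE.sq {u v θ : ℝ} (hs : 1 < s) (hθ : 1 < s * θ) (hθ1 : θ ≤ 1) (hu : ‖A‖ ≤ Real.exp u)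
    (hA : DecayLE b A 1 0 s (Real.exp v)) :
    DecayLE b (A * A) 1 0 s
      (2 ^ s * decaySum (s * θ) * 2 * Real.exp ((1 - θ) * u + (1 + θ) * v)) := by
  have hθ0 : 0 < θ := pos_of_mul_pos_right (by linarith : 0 < s * θ) (by linarith)
  have hA' : DecayLE b A 1 0 (s * θ) (Real.exp ((1 - θ) * u + θ * v)) := by
    intro m n
    set x := ‖inner 𝕜 (b m) (A (b n))‖
    have hx : 0 ≤ x := norm_nonneg _
    have h1 : x ≤ Real.exp u := (norm_entry_le m n).trans hu
    have h2 := hA m n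
    rw [decay_one_zero] at h2 ⊢
    have hP : (0 : ℝ) ≤ 1 + |(m : ℝ) - n| := by positivity
    calc x = x ^ ((1 - θ) + θ) := by simp
      _ = x ^ (1 - θ) * x ^ θ := Real.rpow_add_of_nonneg hx (by linarith) hθ0.le
      _ ≤ (Real.exp u) ^ (1 - θ) * (Real.exp v * (1 + |(m : ℝ) - n|) ^ (-s)) ^ θ := by
          gcongr
      _ = _ := by
          rw [Real.mul_rpow (by positivity) (by positivity), ← Real.exp_mul, ← Real.exp_mul,
            ← Real.rpow_mul hP, Real.exp_add, ← neg_mul, mul_comm u, mul_comm v]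
          ring
  intro m n
  refine (norm_le_decay_of_hasSum one_pos le_rfl le_rfl (by linarith) hθ
    (hasSum_inner_comp b A (b m) (A (b n))) (hA m) (hA' m) (fun k => hA k n)
    (fun k => hA' k n)).trans_eq ?_
  have : Real.exp ((1 - θ) * u + (1 + θ) * v) = Real.exp v * Real.exp ((1 - θ) * u + θ * v) := by
    rw [← Real.exp_add]; ring_nf
  rw [this]
  ring

/-- The powers of a strict contraction with polynomial decay become small in the norm that measures
the decay, with the same exponent. -/
lemma exists_pow_decayLE {ε : ℝ} (hs : 1 < s) (hA : DecayLE b A 1 0 s C) (hn : ‖A‖ < 1)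
    (hε : 0 < ε) : ∃ J : ℕ, J ≠ 0 ∧ DecayLE b (A ^ J) 1 0 s ε := by
  obtain ⟨r, hr, hr1⟩ := exists_between hn
  have hr0 : 0 < r := (norm_nonneg _).trans_lt hr
  set l : ℝ := -Real.log r with hl
  have hl0 : 0 < l := by have := Real.log_neg hr0 hr1; linarith
  have hrl : r = Real.exp (-l) := by rw [hl, neg_neg, Real.exp_log hr0]
  obtain ⟨θ, hθ, hθ1⟩ : ∃ θ : ℝ, 1 < s * θ ∧ θ < 1 := by
    obtain ⟨θ, h1, h2⟩ := exists_between (show 1 / s < 1 by rw [div_lt_one (by linarith)]; exact hs)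
    refine ⟨θ, ?_, h2⟩
    rwa [div_lt_iff₀ (by linarith), mul_comm] at h1
  have hθ0 : 0 < θ := pos_of_mul_pos_right (by linarith : 0 < s * θ) (by linarith)
  set K : ℝ := 2 ^ s * decaySum (s * θ) * 2 with hK
  have hK0 : 0 < K := by have := decaySum_pos hθ; positivity
  set κ : ℝ := Real.log K / θ with hκ
  have hKκ : K = Real.exp (κ * θ) := by
    rw [hκ, div_mul_cancel₀ _ hθ0.ne', Real.exp_log hK0]
  set C' : ℝ := max C 1
  have hC' : 0 < C' := lt_max_of_lt_right one_pos
  set M : ℝ := l + κ + Real.log C' with hM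
  have key : ∀ i : ℕ, ‖A ^ 2 ^ i‖ ≤ Real.exp (-l * 2 ^ i) ∧
      DecayLE b (A ^ 2 ^ i) 1 0 s (Real.exp (-l * 2 ^ i + M * (1 + θ) ^ i - κ)) := by
    intro i
    induction i with
    | zero =>
      refine ⟨by simpa [← hrl] using hr.le, ?_⟩
      have : -l * 2 ^ 0 + M * (1 + θ) ^ 0 - κ = Real.log C' := by rw [hM]; ring
      rw [this, Real.exp_log hC', pow_zero, pow_one]
      exact hA.mono (le_max_left _ _)
    | succ i ih =>
      have hp : A ^ 2 ^ (i + 1) = A ^ 2 ^ i * A ^ 2 ^ i := by rw [← pow_add]; ring_nf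
      rw [hp]
      refine ⟨(norm_mul_le _ _).trans ((mul_le_mul ih.1 ih.1 (norm_nonneg _)
        (Real.exp_pos _).le).trans_eq ?_), ?_⟩
      · rw [← Real.exp_add]; ring_nf
      · have := ih.2.sq hs hθ hθ1.le ih.1
        rw [← hK, hKκ, ← Real.exp_add] at this
        convert this using 2
        ring
  have hlim : Filter.Tendsto (fun i : ℕ => Real.exp (-l * 2 ^ i + M * (1 + θ) ^ i - κ))
      Filter.atTop (𝓝 0) := by
    refine Real.tendsto_exp_atBot.comp (Filter.tendsto_atBot_add_const_right _ _ ?_)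
    have h1 : Filter.Tendsto (fun i : ℕ => ((1 + θ) / 2) ^ i) Filter.atTop (𝓝 0) :=
      tendsto_pow_atTop_nhds_zero_of_lt_one (by positivity) (by linarith)
    have h2 : Filter.Tendsto (fun i : ℕ => -l + M * ((1 + θ) / 2) ^ i) Filter.atTop (𝓝 (-l)) := by
      simpa using (h1.const_mul M).const_add (-l)
    have h3 := (tendsto_pow_atTop_atTop_of_one_lt (one_lt_two (α := ℝ))).atTop_mul_neg
      (by linarith : -l < 0) h2
    refine h3.congr fun i => ?_
    rw [div_pow]
    field_simp
  obtain ⟨i, hi⟩ := ((tendsto_order.1 hlim).2 ε hε).exists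
  exact ⟨2 ^ i, by positivity, (key i).2.mono hi.le⟩

/-- Inverse-closedness: the inverse of `1 - A` inherits the decay of a strict contraction `A`. -/
lemma exists_decayLE_inverse (hβ : 0 < β) (hβ1 : β ≤ 1) (hc : 0 ≤ c) (hs : 1 < s)
    (hA : DecayLE b A β c s C) (hn : ‖A‖ < 1) (hB : B * (1 - A) = 1) :
    ∃ θ D : ℝ, 0 < θ ∧ θ ≤ 1 ∧ DecayLE b B β (θ * c) s D := by
  set K : ℝ := 2 ^ s * decaySum s * 2 with hK
  have hK0 : 0 < K := by have := decaySum_pos hs; positivity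
  have hA0 : DecayLE b A 1 0 s C := fun m n => (hA m n).trans
    (mul_le_mul_of_nonneg_left (by
      rw [decay_one_zero]; exact decay_le_rpow (abs_nonneg _) hc) hA.nonneg)
  obtain ⟨J, hJ, hJA⟩ := exists_pow_decayLE hs hA0 hn (show 0 < 1 / (4 * K) by positivity)
  obtain ⟨D₁, hD₁⟩ := exists_decayLE_pow hβ hβ1 hc hs hA J
  obtain ⟨θ, hθ0, hθ1, hP⟩ := DecayLE.interpolate (by positivity) hJA hD₁
  have hθc : θ * c ≤ c := by nlinarith
  have hθc0 : 0 ≤ θ * c := by positivity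
  obtain ⟨D₂, hD₂⟩ := exists_decayLE_geom_sum hβ hβ1 hc hs hA J
  set P := A ^ J
  have hPn : ‖P‖ < 1 := (norm_pow_le' A (Nat.pos_of_ne_zero hJ)).trans_lt
    (pow_lt_one₀ (norm_nonneg _) hn hJ)
  have hpow : ∀ k : ℕ, DecayLE b (P ^ k) β (θ * c) s ((1 / 2) ^ k) := by
    intro k
    induction k with
    | zero => simpa using decayLE_one hβ
    | succ k ih =>
      rw [pow_succ]
      convert ih.mul hβ hβ1 hθc0 hs hP using 1
      rw [← hK, pow_succ]
      field_simp
      norm_num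
  have hsum : Summable fun k : ℕ => P ^ k := summable_geometric_of_norm_lt_one hPn
  set Q := ∑' k : ℕ, P ^ k
  have hQ : (1 - P) * Q = 1 := mul_neg_geom_series P hPn
  have hQD : DecayLE b Q β (θ * c) s 2 := by
    intro m n
    have h1 : HasSum (fun k : ℕ => inner 𝕜 (b m) ((P ^ k) (b n))) (inner 𝕜 (b m) (Q (b n))) :=
      (hsum.hasSum.mapL (ContinuousLinearMap.apply 𝕜 H (b n))).mapL (innerSL 𝕜 (b m))
    exact h1.norm_le_of_bounded (hasSum_geometric_two.mul_right _) fun k => hpow k m n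
  have hBQ : B = (∑ l ∈ Finset.range J, A ^ l) * Q := by
    calc B = B * (((1 - A) * ∑ l ∈ Finset.range J, A ^ l) * Q) := by
          rw [mul_neg_geom_sum, hQ, mul_one]
      _ = _ := by rw [mul_assoc, ← mul_assoc B, hB, one_mul]
  exact ⟨θ, _, hθ0, hθ1, hBQ ▸ (hD₂.mono_rate hθc).mul hβ hβ1 hθc0 hs hQD⟩

end Matrices

section Schur

variable {𝕜 : Type*} [RCLike 𝕜]

lemma wNorm_eq {p : ℝ} (hp : 0 ≤ p) {μ : ℝ → ℝ} (hμ : ∀ n : ℕ+, 0 ≤ μ n) (a : ℕ+ → 𝕜) :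
    wNorm p μ a = (∑' n : ℕ+, (‖a n‖ₑ * ENNReal.ofReal (μ n)) ^ p) ^ (1 / p) := by
  unfold wNorm
  congr 1
  refine tsum_congr fun n => ?_
  rw [← ofReal_norm, ← ENNReal.ofReal_mul (norm_nonneg _),
    ENNReal.ofReal_rpow_of_nonneg (mul_nonneg (norm_nonneg _) (hμ n)) hp,
    Real.mul_rpow (norm_nonneg _) (hμ n)]

/-- Schur's test for sums in `[0, ∞]`. -/
lemma tsum_rpow_le_of_schur {ι : Type*} {p : ℝ} (hp : 1 ≤ p) {κ : ι → ι → ℝ≥0∞} {Λ : ℝ≥0∞}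
    (hrow : ∀ n, ∑' m, κ n m ≤ Λ) (hcol : ∀ m, ∑' n, κ n m ≤ Λ) (x : ι → ℝ≥0∞) :
    ∑' n, (∑' m, κ n m * x m) ^ p ≤ Λ ^ p * ∑' m, x m ^ p := by
  have hp0 : 0 < p := by linarith
  have hp1 : 0 ≤ 1 - p⁻¹ := by
    have := inv_le_one_of_one_le₀ hp
    linarith
  have h1 : ∀ n, (∑' m, κ n m * x m) ^ p ≤ Λ ^ (p - 1) * ∑' m, κ n m * x m ^ p := by
    intro n
    have h : ∑' m, κ n m * x m ≤ Λ ^ (1 - p⁻¹) * (∑' m, κ n m * x m ^ p) ^ p⁻¹ := by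
      refine ENNReal.summable.tsum_le_of_sum_le fun F => ?_
      refine (ENNReal.inner_le_weight_mul_Lp_of_nonneg F hp (κ n) x).trans ?_
      refine mul_le_mul' (ENNReal.rpow_le_rpow ((ENNReal.sum_le_tsum F).trans (hrow n)) hp1)
        (ENNReal.rpow_le_rpow (ENNReal.sum_le_tsum F) (by positivity))
    refine (ENNReal.rpow_le_rpow h hp0.le).trans_eq ?_
    rw [ENNReal.mul_rpow_of_nonneg _ _ hp0.le, ← ENNReal.rpow_mul, ← ENNReal.rpow_mul,
      inv_mul_cancel₀ hp0.ne', ENNReal.rpow_one, sub_mul, one_mul, inv_mul_cancel₀ hp0.ne']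
  calc ∑' n, (∑' m, κ n m * x m) ^ p
      ≤ ∑' n, Λ ^ (p - 1) * ∑' m, κ n m * x m ^ p := ENNReal.tsum_le_tsum h1
    _ = Λ ^ (p - 1) * ∑' m, (∑' n, κ n m) * x m ^ p := by
        rw [ENNReal.tsum_mul_left, ENNReal.tsum_comm]
        simp only [ENNReal.tsum_mul_right]
    _ ≤ Λ ^ (p - 1) * ∑' m, Λ * x m ^ p := by gcongr with m; exact hcol m
    _ = Λ ^ p * ∑' m, x m ^ p := by
        rw [ENNReal.tsum_mul_left, ← mul_assoc]
        congr 1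
        nth_rewrite 2 [← ENNReal.rpow_one Λ]
        rw [← ENNReal.rpow_add_of_nonneg _ _ (by linarith) (by linarith)]
        ring_nf

/-- A matrix with enough off-diagonal decay is bounded on `ℓ^p_μ`. -/
lemma wNorm_le_of_hasSum {p σ K : ℝ} (hp : 1 ≤ p) (hσ : 1 < σ) (hK : 0 ≤ K) {μ : ℝ → ℝ}
    (hμ : ∀ n : ℕ+, 0 ≤ μ n) {M : ℕ+ → ℕ+ → 𝕜} {a c : ℕ+ → 𝕜}
    (ha : ∀ n, HasSum (fun m => M n m * c m) (a n))
    (hM : ∀ n m : ℕ+, ‖M n m‖ * μ n ≤ K * (1 + |(n : ℝ) - m|) ^ (-σ) * μ m) :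
    wNorm p μ a ≤ ENNReal.ofReal (K * decaySum σ) * wNorm p μ c := by
  have hp0 : 0 < p := by linarith
  rw [wNorm_eq hp0.le hμ, wNorm_eq hp0.le hμ]
  set κ : ℕ+ → ℕ+ → ℝ≥0∞ := fun n m => ENNReal.ofReal (K * (1 + |(n : ℝ) - m|) ^ (-σ))
  have hrow : ∀ n, ∑' m, κ n m ≤ ENNReal.ofReal (K * decaySum σ) := by
    intro n
    rw [← ENNReal.ofReal_tsum_of_nonneg (fun m => by positivity)
      ((summable_dist_rpow hσ n).mul_left K), tsum_mul_left]
    exact ENNReal.ofReal_le_ofReal (mul_le_mul_of_nonneg_left (tsum_dist_rpow_le hσ n) hK)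
  have hcol : ∀ m, ∑' n, κ n m ≤ ENNReal.ofReal (K * decaySum σ) := by
    intro m
    refine le_trans (le_of_eq (tsum_congr fun n => ?_)) (hrow m)
    simp only [κ, abs_sub_comm]
  have hle : ∀ n, ‖a n‖ₑ * ENNReal.ofReal (μ n) ≤
      ∑' m, κ n m * (‖c m‖ₑ * ENNReal.ofReal (μ m)) := by
    intro n
    rw [← (ha n).tsum_eq]
    refine (mul_le_mul_left (enorm_tsum_le_tsum_enorm) _).trans ?_
    rw [← ENNReal.tsum_mul_right]
    refine ENNReal.tsum_le_tsum fun m => ?_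
    rw [enorm_mul, mul_right_comm, mul_left_comm, mul_comm _ ‖c m‖ₑ]
    refine mul_le_mul_right ?_ _
    rw [← ofReal_norm, ← ENNReal.ofReal_mul (norm_nonneg _),
      ← ENNReal.ofReal_mul (by positivity)]
    exact ENNReal.ofReal_le_ofReal (hM n m)
  calc _ ≤ (∑' n, (∑' m, κ n m * (‖c m‖ₑ * ENNReal.ofReal (μ m))) ^ p) ^ (1 / p) := by
        gcongr with n
        exact hle n
    _ ≤ (ENNReal.ofReal (K * decaySum σ) ^ p *
          ∑' m, (‖c m‖ₑ * ENNReal.ofReal (μ m)) ^ p) ^ (1 / p) := by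
        gcongr
        exact tsum_rpow_le_of_schur hp hrow hcol _
    _ = _ := by
        rw [ENNReal.mul_rpow_of_nonneg _ _ (by positivity), ← ENNReal.rpow_mul,
          mul_one_div_cancel hp0.ne', ENNReal.rpow_one]

end Schur

section Weights

/-- A lower power of `d` is dominated by a small multiple of a higher one. -/
lemma exists_rpow_le_add {α β γ δ : ℝ} (hα : 0 < α) (hαβ : α < β) (hγ : 0 ≤ γ) (hδ : 0 < δ) :
    ∃ M : ℝ, ∀ d : ℝ, 0 ≤ d → γ * d ^ α ≤ M + δ * d ^ β := by
  refine ⟨γ * ((γ / δ) ^ (1 / (β - α))) ^ α, fun d hd => ?_⟩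
  rcases le_total d ((γ / δ) ^ (1 / (β - α))) with h | h
  · have : γ * d ^ α ≤ γ * ((γ / δ) ^ (1 / (β - α))) ^ α := by gcongr
    have h2 : 0 ≤ δ * d ^ β := by positivity
    linarith
  · have h1 : γ / δ ≤ d ^ (β - α) := by
      have := Real.rpow_le_rpow (by positivity) h (by linarith : 0 ≤ β - α)
      rwa [← Real.rpow_mul (by positivity), one_div_mul_cancel (by linarith), Real.rpow_one] at this
    have h2 : d ^ β = d ^ (β - α) * d ^ α := by
      rw [← Real.rpow_add_of_nonneg hd (by linarith) hα.le]; ring_nf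
    have h3 : γ ≤ δ * d ^ (β - α) := by rwa [div_le_iff₀' hδ] at h1
    have h4 : 0 ≤ γ * ((γ / δ) ^ (1 / (β - α))) ^ α := by positivity
    have h5 : 0 ≤ d ^ α := by positivity
    rw [h2]
    nlinarith [mul_le_mul_of_nonneg_right h3 h5]

lemma exists_exp_le_decay {β γ : ℝ} (hβ : 0 < β) (hβ1 : β ≤ 1) (hγ : 0 < γ) :
    ∃ C : ℝ, 0 < C ∧ ∀ d : ℝ, 0 ≤ d → Real.exp (-γ * d ^ β) ≤ C * decay β (γ / 2) 2 d := by
  obtain ⟨M, hM⟩ := exists_rpow_le_add (show 0 < β / 2 by linarith) (show β / 2 < β by linarith)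
    (show 0 ≤ 4 / β by positivity) (show 0 < γ / 2 by linarith)
  refine ⟨Real.exp (4 / β + M), Real.exp_pos _, fun d hd => ?_⟩
  have h1 : Real.log (1 + d) ≤ (1 + d) ^ (β / 2) / (β / 2) :=
    Real.log_le_rpow_div (by positivity) (by linarith)
  have h2 : (1 + d) ^ (β / 2) ≤ 1 + d ^ (β / 2) := by
    simpa using Real.rpow_add_le_add_rpow zero_le_one hd (by linarith : 0 ≤ β / 2) (by linarith)
  have h3 : 2 * Real.log (1 + d) ≤ 4 / β + 4 / β * d ^ (β / 2) := by
    have : (1 + d) ^ (β / 2) / (β / 2) ≤ (1 + d ^ (β / 2)) / (β / 2) := by gcongr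
    have e : (1 + d ^ (β / 2)) / (β / 2) * 2 = 4 / β + 4 / β * d ^ (β / 2) := by
      field_simp
      ring
    linarith
  have h4 := hM d hd
  have h5 : (1 + d) ^ (-2 : ℝ) = Real.exp (-(2 * Real.log (1 + d))) := by
    rw [Real.rpow_def_of_pos (by positivity)]; ring_nf
  unfold decay
  rw [h5, ← Real.exp_add, ← Real.exp_add]
  apply Real.exp_le_exp.2
  nlinarith

/-- The decay compensates the growth of a sub-exponential weight. -/
lemma IsSubexpWeight.exists_decay_mul_le {α β c : ℝ} {μ : ℝ → ℝ} (h : IsSubexpWeight α μ)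
    (hαβ : α < β) (hc : 0 < c) :
    ∃ K : ℝ, 0 ≤ K ∧ ∀ m n : ℕ+,
      decay β c 2 |(m : ℝ) - n| * μ m ≤ K * (1 + |(m : ℝ) - n|) ^ (-2 : ℝ) * μ n := by
  obtain ⟨hα, -, -, hpos, C, hC, γ, hγ, hμ⟩ := h
  obtain ⟨M, hM⟩ := exists_rpow_le_add hα hαβ hγ.le hc
  refine ⟨C * Real.exp M, by positivity, fun m n => ?_⟩
  have h1 := hμ ((m : ℝ) - n) n
  rw [sub_add_cancel] at h1
  set d := |(m : ℝ) - n|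
  have hd : 0 ≤ d := abs_nonneg _
  have h2 := hM d hd
  have hn := hpos n
  calc decay β c 2 d * μ m ≤ decay β c 2 d * (C * Real.exp (γ * d ^ α) * μ n) :=
        mul_le_mul_of_nonneg_left h1 (decay_pos hd).le
    _ = C * Real.exp (γ * d ^ α - c * d ^ β) * (1 + d) ^ (-2 : ℝ) * μ n := by
        unfold decay
        rw [sub_eq_add_neg, Real.exp_add, neg_mul]
        ring
    _ ≤ C * Real.exp M * (1 + d) ^ (-2 : ℝ) * μ n := by
        gcongr
        linarith

lemma IsModerateWeight.exists_decay_mul_le {k ε : ℝ} {μ : ℝ → ℝ} (h : IsModerateWeight k μ) :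
    ∃ K : ℝ, 0 ≤ K ∧ ∀ m n : ℕ+, decay 1 0 (k + 1 + ε) |(m : ℝ) - n| * μ m ≤
      K * (1 + |(m : ℝ) - n|) ^ (-(1 + ε)) * μ n := by
  obtain ⟨-, -, hpos, C, hC, hμ⟩ := h
  refine ⟨C, hC.le, fun m n => ?_⟩
  have h1 := hμ ((m : ℝ) - n) n
  rw [sub_add_cancel] at h1
  set d := |(m : ℝ) - n|
  have hd : 0 ≤ d := abs_nonneg _
  refine (mul_le_mul_of_nonneg_left h1 (decay_pos hd).le).trans_eq ?_
  have : (1 + d) ^ (-(1 + ε)) = (1 + d) ^ (-(k + 1 + ε)) * (1 + d) ^ k := by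
    rw [← Real.rpow_add (by positivity)]; ring_nf
  rw [decay_one_zero, this]
  ring

variable {𝕜 H : Type*} [RCLike 𝕜] [NormedAddCommGroup H] [InnerProductSpace 𝕜 H]

lemma LocBound.mono {g e : ℕ+ → H} {v w : ℝ → ℝ} (h : LocBound 𝕜 g e v)
    (hvw : ∀ d, 0 ≤ d → v d ≤ w d) : LocBound 𝕜 g e w := fun m n =>
  (h m n).trans (hvw _ (abs_nonneg _))

lemma subexp_decay_spec {g e : ℕ+ → H} {α β γ C : ℝ} {μ : ℝ → ℝ} (hβ : 0 < β) (hβ1 : β ≤ 1)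
    (hγ : 0 < γ) (hC : 0 < C) (he : LocBound 𝕜 g e (fun d => C * Real.exp (-γ * d ^ β)))
    (hμ : IsSubexpWeight α μ) (hα : α < β) :
    ∃ c : ℝ, 0 < c ∧ (∃ C, LocBound 𝕜 g e (fun d => C * decay β c 2 d)) ∧
    ∀ θ : ℝ, 0 < θ → θ ≤ 1 →
      (∀ (e' : ℕ+ → H) (C : ℝ), LocBound 𝕜 g e' (fun d => C * decay β (θ * c) 2 d) →
        ∃ γ > 0, ∃ C > 0, LocBound 𝕜 g e' (fun d => C * Real.exp (-γ * d ^ β))) ∧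
      ∃ σ K : ℝ, 1 < σ ∧ 0 ≤ K ∧ ∀ m n : ℕ+, decay β (θ * c) 2 |(m : ℝ) - n| * μ m ≤
        K * (1 + |(m : ℝ) - n|) ^ (-σ) * μ n := by
  obtain ⟨D, hD, h⟩ := exists_exp_le_decay hβ hβ1 hγ
  refine ⟨γ / 2, by positivity, ⟨C * D, he.mono fun d hd => ?_⟩, fun θ hθ _ => ⟨?_, ?_⟩⟩
  · rw [mul_assoc]
    exact mul_le_mul_of_nonneg_left (h d hd) hC.le
  · intro e' C' h'
    refine ⟨θ * (γ / 2), by positivity, max C' 1, lt_max_of_lt_right one_pos,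
      h'.mono fun d hd => mul_le_mul (le_max_left _ _) ?_ (decay_pos hd).le (by positivity)⟩
    exact mul_le_of_le_one_right (Real.exp_pos _).le
      (Real.rpow_le_one_of_one_le_of_nonpos (by linarith) (by norm_num))
  · obtain ⟨K, hK, hKb⟩ := hμ.exists_decay_mul_le hα (show 0 < θ * (γ / 2) by positivity)
    exact ⟨2, K, by norm_num, hK, hKb⟩

/-- All types of localization are described by the functions `decay β c s`, up to a change of the
rate `c`, and the admissible weights are controlled by these functions. -/
lemma IsLocalized.exists_decay {g e : ℕ+ → H} {t : LocType} {μ : ℝ → ℝ} (he : IsLocalized 𝕜 g e t)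
    (hμ : IsAdmissibleWeight μ t) :
    ∃ β c s : ℝ, 0 < β ∧ β ≤ 1 ∧ 0 ≤ c ∧ 1 < s ∧
      (∃ C, LocBound 𝕜 g e (fun d => C * decay β c s d)) ∧
      ∀ θ : ℝ, 0 < θ → θ ≤ 1 →
        (∀ (e' : ℕ+ → H) (C : ℝ), LocBound 𝕜 g e' (fun d => C * decay β (θ * c) s d) →
          IsLocalized 𝕜 g e' t) ∧
        ∃ σ K : ℝ, 1 < σ ∧ 0 ≤ K ∧ ∀ m n : ℕ+, decay β (θ * c) s |(m : ℝ) - n| * μ m ≤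
          K * (1 + |(m : ℝ) - n|) ^ (-σ) * μ n := by
  cases t with
  | poly s =>
    obtain ⟨k, ε, hε, hs, hw⟩ := hμ
    obtain ⟨hs0, C, hC, hb⟩ := he
    have hk := hw.1
    refine ⟨1, 0, s, one_pos, le_rfl, le_rfl, by linarith, ⟨C, ?_⟩, fun θ hθ _ => ⟨?_, ?_⟩⟩
    · simpa only [decay_one_zero] using hb
    · intro e' C' h'
      refine ⟨hs0, max C' 1, lt_max_of_lt_right one_pos, h'.mono fun d hd => ?_⟩
      rw [mul_zero, decay_one_zero]
      gcongr
      exact le_max_left _ _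
    · obtain ⟨K, hK, hKb⟩ := hw.exists_decay_mul_le (ε := ε)
      rw [mul_zero, hs]
      exact ⟨1 + ε, K, by linarith, hK, hKb⟩
  | subexp β =>
    obtain ⟨α, hα, hw⟩ := hμ
    obtain ⟨hβ, hβ1, γ, hγ, C, hC, hb⟩ := he
    obtain ⟨c, hc, h1, h2⟩ := subexp_decay_spec hβ hβ1.le hγ hC hb hw hα
    exact ⟨β, c, 2, hβ, hβ1.le, hc.le, by norm_num, h1, fun θ hθ hθ1 =>
      ⟨fun e' C' h' => ⟨hβ, hβ1, (h2 θ hθ hθ1).1 e' C' h'⟩, (h2 θ hθ hθ1).2⟩⟩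
  | exp =>
    obtain ⟨α, hw⟩ := hμ
    obtain ⟨γ, hγ, C, hC, hb⟩ := he
    obtain ⟨c, hc, h1, h2⟩ := subexp_decay_spec one_pos le_rfl hγ hC
      (by simpa only [Real.rpow_one] using hb) hw hw.2.1
    refine ⟨1, c, 2, one_pos, le_rfl, hc.le, by norm_num, h1, fun θ hθ hθ1 =>
      ⟨fun e' C' h' => ?_, (h2 θ hθ hθ1).2⟩⟩
    have := (h2 θ hθ hθ1).1 e' C' h'
    simp only [Real.rpow_one] at this
    exact this

end Weights

section DualFrame

variable {𝕜 H : Type*} [RCLike 𝕜] [NormedAddCommGroup H] [InnerProductSpace 𝕜 H]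

/-- A coercive operator is a multiple of a perturbation of the identity by a strict contraction. -/
lemma exists_norm_one_sub_smul_lt {N : H →L[𝕜] H} {α : ℝ} (hα : 0 < α)
    (hN : ∀ x, α * ‖x‖ ^ 2 ≤ RCLike.re (inner 𝕜 x (N x))) :
    ∃ t : ℝ, 0 < t ∧ ‖1 - (t : 𝕜) • N‖ < 1 := by
  set M : ℝ := ‖N‖ + α with hM
  have hM0 : 0 < M := by positivity
  have hαM : α ≤ M := by simp [hM]
  refine ⟨α / M ^ 2, by positivity, ?_⟩
  set t := α / M ^ 2 with ht
  have ht0 : 0 < t := by positivity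
  have hq : 0 ≤ 1 - α ^ 2 / M ^ 2 := by
    rw [sub_nonneg, div_le_one (by positivity)]
    gcongr
  have hq1 : 1 - α ^ 2 / M ^ 2 < 1 := by
    have : 0 < α ^ 2 / M ^ 2 := by positivity
    linarith
  refine (ContinuousLinearMap.opNorm_le_bound _ (Real.sqrt_nonneg (1 - α ^ 2 / M ^ 2))
    fun x => ?_).trans_lt ((Real.sqrt_lt' one_pos).2 (by simpa using hq1))
  refine le_of_sq_le_sq ?_ (by positivity)
  rw [mul_pow, Real.sq_sqrt hq]
  have e1 : (1 - (t : 𝕜) • N) x = x - (t : 𝕜) • N x := rfl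
  have h1 := hN x
  have h2 : ‖N x‖ ^ 2 ≤ M ^ 2 * ‖x‖ ^ 2 := by
    rw [← mul_pow]
    have := N.le_opNorm x
    gcongr
    refine this.trans (mul_le_mul_of_nonneg_right ?_ (norm_nonneg _))
    linarith
  rw [e1, norm_sub_sq (𝕜 := 𝕜), inner_smul_right, RCLike.re_ofReal_mul, norm_smul,
    RCLike.norm_ofReal, abs_of_pos ht0, mul_pow]
  have h3 : t ^ 2 * ‖N x‖ ^ 2 ≤ t ^ 2 * (M ^ 2 * ‖x‖ ^ 2) := by gcongr
  have h4 : t * (α * ‖x‖ ^ 2) ≤ t * RCLike.re (inner 𝕜 x (N x)) := by gcongr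
  have h5 : t ^ 2 * (M ^ 2 * ‖x‖ ^ 2) = α ^ 2 / M ^ 2 * ‖x‖ ^ 2 := by
    rw [ht]; field_simp
  have h6 : t * (α * ‖x‖ ^ 2) = α ^ 2 / M ^ 2 * ‖x‖ ^ 2 := by
    rw [ht]; field_simp
  linarith

variable [CompleteSpace H]

/-- If `e` has a coercive frame operator `S` and is localized with respect to the Riesz basis
`T bₙ`, then `S⁻¹ e` is localized with respect to the dual Riesz basis `(T⁻¹)* bₙ`. -/
lemma exists_decay_dual (b : HilbertBasis ℕ+ 𝕜 H) {T T' S S' : H →L[𝕜] H} (hT : T * T' = 1)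
    (hT' : T' * T = 1) (hS' : S' * S = 1) {e : ℕ+ → H}
    (hS : ∀ f, HasSum (fun n => inner 𝕜 (e n) f • e n) (S f)) {α : ℝ} (hα : 0 < α)
    (hSα : ∀ x, α * ‖x‖ ^ 2 ≤ RCLike.re (inner 𝕜 x (S x))) {β c s C : ℝ} (hβ : 0 < β)
    (hβ1 : β ≤ 1) (hc : 0 ≤ c) (hs : 1 < s)
    (he : ∀ m n : ℕ+, ‖inner 𝕜 (T (b n)) (e m)‖ ≤ C * decay β c s |(m : ℝ) - n|) :
    ∃ θ D : ℝ, 0 < θ ∧ θ ≤ 1 ∧ ∀ m n : ℕ+,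
      ‖inner 𝕜 (T'.adjoint (b n)) (S' (e m))‖ ≤ D * decay β (θ * c) s |(m : ℝ) - n| := by
  set N : H →L[𝕜] H := T.adjoint * S * T
  have hC : 0 ≤ C :=
    nonneg_of_mul_nonneg_left ((norm_nonneg _).trans (he 1 1)) (decay_pos (abs_nonneg _))
  have hN : ∀ x y, inner 𝕜 x (N y) = inner 𝕜 (T x) (S (T y)) := fun x y =>
    ContinuousLinearMap.adjoint_inner_right T x _
  have hND : DecayLE b N β c s (2 ^ s * decaySum s * (C * C + C * C)) := by
    intro m n
    have h1 : HasSum (fun k => inner 𝕜 (T (b m)) (e k) * inner 𝕜 (e k) (T (b n)))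
        (inner 𝕜 (b m) (N (b n))) := by
      rw [hN]
      have := (hS (T (b n))).mapL (innerSL 𝕜 (T (b m)))
      simpa [inner_smul_right, mul_comm] using this
    have h2 : ∀ k : ℕ+, ‖inner 𝕜 (T (b m)) (e k)‖ ≤ C * decay β c s |(m : ℝ) - k| := fun k => by
      rw [abs_sub_comm]; exact he k m
    have h3 : ∀ k : ℕ+, ‖inner 𝕜 (e k) (T (b n))‖ ≤ C * decay β c s |(k : ℝ) - n| := fun k => by
      rw [norm_inner_symm]; exact he k n
    exact norm_le_decay_of_hasSum hβ hβ1 hc (by linarith) hs h1 h2 h2 h3 h3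
  set K : ℝ := ‖T'‖ + 1
  have hNα : ∀ x, α / K ^ 2 * ‖x‖ ^ 2 ≤ RCLike.re (inner 𝕜 x (N x)) := by
    intro x
    rw [hN]
    refine le_trans ?_ (hSα (T x))
    have h1 : ‖x‖ ≤ K * ‖T x‖ := by
      have h2 := T'.le_opNorm (T x)
      have h3 : T' (T x) = x := DFunLike.congr_fun hT' x
      rw [h3] at h2
      exact h2.trans (mul_le_mul_of_nonneg_right (by simp [K]) (norm_nonneg _))
    calc α / K ^ 2 * ‖x‖ ^ 2 ≤ α / K ^ 2 * (K * ‖T x‖) ^ 2 := by gcongr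
      _ = α * ‖T x‖ ^ 2 := by
        have : K ≠ 0 := by positivity
        field_simp
  obtain ⟨t, ht, htN⟩ := exists_norm_one_sub_smul_lt (by positivity) hNα
  set B : H →L[𝕜] H := T' * S' * T'.adjoint
  have hTa : T'.adjoint * T.adjoint = 1 := by
    have := congrArg star hT
    rw [star_mul, star_one] at this
    exact this
  have hBN : B * N = 1 := by
    calc B * N = T' * (S' * ((T'.adjoint * T.adjoint) * S)) * T := by simp only [B, N, mul_assoc]
      _ = 1 := by rw [hTa, one_mul, hS', mul_one, hT']
  have ht' : (t : 𝕜) ≠ 0 := by exact_mod_cast ht.ne'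
  have hinv : ((t : 𝕜)⁻¹ • B) * (1 - (1 - (t : 𝕜) • N)) = 1 := by
    rw [sub_sub_cancel, smul_mul_smul_comm, inv_mul_cancel₀ ht', hBN, one_smul]
  obtain ⟨E, hA⟩ : ∃ E, DecayLE b (1 - (t : 𝕜) • N) β c s E := by
    rw [sub_eq_add_neg, ← neg_smul]
    exact ⟨_, (decayLE_one hβ).add (hND.smul _)⟩
  obtain ⟨θ, D, hθ, hθ1, hD⟩ := exists_decayLE_inverse hβ hβ1 hc hs hA htN hinv
  have hBD : DecayLE b B β (θ * c) s (‖(t : 𝕜)‖ * D) := by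
    have := hD.smul (t : 𝕜)
    rwa [smul_smul, mul_inv_cancel₀ ht', one_smul] at this
  refine ⟨θ, 2 ^ s * decaySum s * (‖(t : 𝕜)‖ * D * C + ‖(t : 𝕜)‖ * D * C), hθ, hθ1,
    fun m n => ?_⟩
  have hθc : θ * c ≤ c := by nlinarith
  have h1 : HasSum (fun k => inner 𝕜 (b n) (B (b k)) * inner 𝕜 (b k) (T.adjoint (e m)))
      (inner 𝕜 (T'.adjoint (b n)) (S' (e m))) := by
    convert hasSum_inner_comp b B (b n) (T.adjoint (e m)) using 1
    rw [ContinuousLinearMap.adjoint_inner_left]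
    have : T'.adjoint (T.adjoint (e m)) = e m := DFunLike.congr_fun hTa (e m)
    simp [B, mul_apply_eq_comp, this]
  have h2 : ∀ k : ℕ+, ‖inner 𝕜 (b k) (T.adjoint (e m))‖ ≤
      C * decay β (θ * c) s |(k : ℝ) - m| := fun k => by
    rw [ContinuousLinearMap.adjoint_inner_right, abs_sub_comm]
    exact (he m k).trans (mul_le_mul_of_nonneg_left (decay_le_of_le (abs_nonneg _) hθc) hC)
  rw [abs_sub_comm]
  exact norm_le_decay_of_hasSum hβ hβ1 (by positivity) (by linarith) hs h1 (hBD n) (hBD n) h2 h2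

end DualFrame

section FrameOperator

variable {𝕜 H : Type*} [RCLike 𝕜] [NormedAddCommGroup H] [InnerProductSpace 𝕜 H] [CompleteSpace H]

/-- The frame operator of a frame as an invertible, symmetric and coercive operator. -/
lemma IsFrame.exists_inverse {e : ℕ+ → H} (he : IsFrame 𝕜 e) :
    ∃ S S' : H →L[𝕜] H, S * S' = 1 ∧ S' * S = 1 ∧
      (∀ f, HasSum (fun n => inner 𝕜 (e n) f • e n) (S f)) ∧
      (∀ x y, inner 𝕜 (S' x) y = inner 𝕜 x (S' y)) ∧
      (∃ α : ℝ, 0 < α ∧ ∀ x, α * ‖x‖ ^ 2 ≤ RCLike.re (inner 𝕜 x (S x))) ∧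
      frameOp 𝕜 e = S ∧ ∀ n, canonicalDual 𝕜 e n = S' (e n) := by
  obtain ⟨S, hS, hs⟩ := he.exists_clm
  have hfo : frameOp 𝕜 e = S := funext fun f => (hs f).tsum_eq
  obtain ⟨S', h1, h2⟩ := isUnit_iff_exists.1 ((ContinuousLinearMap.isUnit_iff_bijective).2 hS)
  have h1' : ∀ x, S (S' x) = x := fun x => DFunLike.congr_fun h1 x
  have hinner : ∀ x y, HasSum (fun n => inner 𝕜 x (e n) * inner 𝕜 (e n) y) (inner 𝕜 x (S y)) := by
    intro x y
    have := (hs y).mapL (innerSL 𝕜 x)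
    simpa [inner_smul_right, analysis, mul_comm] using this
  have hsymm : ∀ x y, inner 𝕜 (S x) y = inner 𝕜 x (S y) := by
    intro x y
    refine HasSum.unique ?_ (hinner x y)
    have := (RCLike.hasSum_conj' 𝕜).2 (hinner y x)
    simpa [mul_comm] using this
  refine ⟨S, S', h1, h2, hs, fun x y => ?_, ?_, hfo, fun n => ?_⟩
  · rw [← h1' y, ← hsymm, h1', h1']
  · obtain ⟨A, B, hA, -, h⟩ := he
    refine ⟨A, hA, fun x => (h x).2.1.trans_eq ?_⟩
    have h3 : HasSum (fun n => ‖inner 𝕜 (e n) x‖ ^ 2) (RCLike.re (inner 𝕜 x (S x))) := by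
      have := RCLike.hasSum_re 𝕜 (hinner x x)
      simpa only [inner_mul_symm_re_eq_norm, norm_mul, norm_inner_symm x, ← sq] using this
    exact h3.tsum_eq
  · have h3 := he.frameOp_canonicalDual (𝕜 := 𝕜) n
    rw [hfo] at h3
    have h4 : S' (S (canonicalDual 𝕜 e n)) = canonicalDual 𝕜 e n := DFunLike.congr_fun h2 _
    rw [← h4, h3]

lemma IsFrame.isFrame_canonicalDual {e : ℕ+ → H} (he : IsFrame 𝕜 e) :
    IsFrame 𝕜 (canonicalDual 𝕜 e) := by
  obtain ⟨S, S', h1, h2, -, hsymm, -, -, hd⟩ := he.exists_inverse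
  obtain ⟨A, B, hA, hB, h⟩ := he
  have ha : ∀ f, analysis 𝕜 (canonicalDual 𝕜 e) f = analysis 𝕜 e (S' f) := fun f => by
    funext n
    simp only [analysis, hd, hsymm]
  have hS : ∀ x, ‖x‖ ≤ (‖S‖ + 1) * ‖S' x‖ := fun x => by
    have h3 := S.le_opNorm (S' x)
    have h4 : S (S' x) = x := DFunLike.congr_fun h1 x
    rw [h4] at h3
    exact h3.trans (mul_le_mul_of_nonneg_right (by simp) (norm_nonneg _))
  have hS' : ∀ x, ‖S' x‖ ≤ (‖S'‖ + 1) * ‖x‖ := fun x =>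
    (S'.le_opNorm x).trans (mul_le_mul_of_nonneg_right (by simp) (norm_nonneg _))
  refine ⟨A / (‖S‖ + 1) ^ 2, B * (‖S'‖ + 1) ^ 2, by positivity, by positivity, fun f => ?_⟩
  rw [ha]
  refine ⟨(h _).1, le_trans ?_ (h _).2.1, (h _).2.2.trans ?_⟩
  · rw [div_mul_eq_mul_div, div_le_iff₀ (by positivity), mul_assoc, mul_comm (_ ^ 2) (_ ^ 2),
      ← mul_pow]
    gcongr
    exact hS f
  · rw [mul_assoc, ← mul_pow]
    gcongr
    exact hS' f

/-- The canonical dual of the Riesz basis `T bₙ` is `(T⁻¹)* bₙ`. -/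
lemma IsRieszBasis.exists_dual {g : ℕ+ → H} (hg : IsRieszBasis 𝕜 g) :
    ∃ (b : HilbertBasis ℕ+ 𝕜 H) (T T' : H →L[𝕜] H), T * T' = 1 ∧ T' * T = 1 ∧
      (∀ n, g n = T (b n)) ∧ ∀ n, canonicalDual 𝕜 g n = T'.adjoint (b n) := by
  obtain ⟨b, T, hT, hgT⟩ := hg
  obtain ⟨T', h1, h2⟩ := isUnit_iff_exists.1 ((ContinuousLinearMap.isUnit_iff_bijective).2 hT)
  refine ⟨b, T, T', h1, h2, hgT, fun n => ?_⟩
  have hTa : T'.adjoint * T.adjoint = 1 := by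
    have := congrArg star h1
    rw [star_mul, star_one] at this
    exact this
  have hTa' : T.adjoint * T'.adjoint = 1 := by
    have := congrArg star h2
    rw [star_mul, star_one] at this
    exact this
  have hfo : frameOp 𝕜 g = T * T.adjoint := by
    funext f
    have h3 := (b.hasSum_repr (T.adjoint f)).mapL T
    have h4 : HasSum (fun n => analysis 𝕜 g f n • g n) ((T * T.adjoint) f) := by
      simpa [analysis, hgT, b.repr_apply_apply, ContinuousLinearMap.adjoint_inner_right] using h3
    exact h4.tsum_eq
  have hinj : Function.Injective (frameOp 𝕜 g) := by
    have h5 : (T'.adjoint * T') * (T * T.adjoint) = 1 := by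
      calc _ = T'.adjoint * ((T' * T) * T.adjoint) := by simp only [mul_assoc]
        _ = 1 := by rw [h2, one_mul, hTa]
    rw [hfo]
    exact Function.LeftInverse.injective (g := (T'.adjoint * T')) fun x => DFunLike.congr_fun h5 x
  have h6 : g n = frameOp 𝕜 g (T'.adjoint (b n)) := by
    have : T.adjoint (T'.adjoint (b n)) = b n := DFunLike.congr_fun hTa' (b n)
    rw [hfo, hgT, mul_apply_eq_comp, this]
  rw [canonicalDual, h6]
  exact Function.leftInverse_invFun hinj _

/-- The canonical dual frame is localized like the frame, up to the rate. -/
lemma exists_locBound_canonicalDual {g e : ℕ+ → H} (hg : IsRieszBasis 𝕜 g) (he : IsFrame 𝕜 e)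
    {β c s C : ℝ} (hβ : 0 < β) (hβ1 : β ≤ 1) (hc : 0 ≤ c) (hs : 1 < s)
    (h : LocBound 𝕜 g e (fun d => C * decay β c s d)) :
    ∃ θ D : ℝ, 0 < θ ∧ θ ≤ 1 ∧
      LocBound 𝕜 g (canonicalDual 𝕜 e) (fun d => D * decay β (θ * c) s d) := by
  obtain ⟨b, T, T', hT, hT', hgT, hgd⟩ := hg.exists_dual
  obtain ⟨S, S', -, hS', hS, -, ⟨α, hα, hSα⟩, -, hd⟩ := he.exists_inverse
  have hTa : T'.adjoint * T.adjoint = 1 := by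
    have := congrArg star hT
    rw [star_mul, star_one] at this
    exact this
  have hTa' : T.adjoint * T'.adjoint = 1 := by
    have := congrArg star hT'
    rw [star_mul, star_one] at this
    exact this
  obtain ⟨θ₁, D₁, hθ₁, hθ₁1, h₁⟩ := exists_decay_dual b hT hT' hS' hS hα hSα hβ hβ1 hc hs
    fun m n => by rw [← hgT]; exact (le_max_left _ _).trans (h m n)
  obtain ⟨θ₂, D₂, hθ₂, hθ₂1, h₂⟩ := exists_decay_dual b hTa hTa' hS' hS hα hSα hβ hβ1 hc hs
    fun m n => by rw [← hgd]; exact (le_max_right _ _).trans (h m n)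
  have hmono : ∀ {θ D d x : ℝ}, 0 ≤ d → 0 ≤ x → x ≤ D * decay β (θ * c) s d →
      min θ₁ θ₂ ≤ θ → D ≤ max D₁ D₂ →
      x ≤ max D₁ D₂ * decay β (min θ₁ θ₂ * c) s d := by
    intro θ D d x hd hx h1 h2 h3
    have hD : 0 ≤ D := nonneg_of_mul_nonneg_left (hx.trans h1) (decay_pos hd)
    exact h1.trans (mul_le_mul h3 (decay_le_of_le hd (mul_le_mul_of_nonneg_right h2 hc))
      (decay_pos hd).le (hD.trans h3))
  refine ⟨min θ₁ θ₂, max D₁ D₂, lt_min hθ₁ hθ₂, (min_le_left _ _).trans hθ₁1, fun m n => ?_⟩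
  rw [hgT, hgd, hd]
  refine max_le (hmono (abs_nonneg _) (norm_nonneg _) ?_ (min_le_right _ _) (le_max_right _ _))
    (hmono (abs_nonneg _) (norm_nonneg _) (h₁ m n) (min_le_left _ _) (le_max_left _ _))
  have := h₂ m n
  rwa [ContinuousLinearMap.adjoint_adjoint] at this

end FrameOperator

section SequenceSpaces

variable {𝕜 : Type*} [RCLike 𝕜] {p : ℝ} {μ : ℝ → ℝ}

lemma wNorm_mono (hp : 0 < p) (hμ : ∀ n : ℕ+, 0 ≤ μ n) {a c : ℕ+ → 𝕜} (h : ∀ n, ‖a n‖ ≤ ‖c n‖) :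
    wNorm p μ a ≤ wNorm p μ c := by
  unfold wNorm
  gcongr with n
  · exact Real.rpow_nonneg (hμ n) _
  · exact h n

lemma tsum_ne_top_of_mem_weightedLp (hp : 0 < p) {c : ℕ+ → 𝕜} (hc : c ∈ weightedLp 𝕜 p μ) :
    ∑' n : ℕ+, ENNReal.ofReal (‖c n‖ ^ p * μ (n : ℝ) ^ p) ≠ ∞ := by
  intro h
  have h1 : wNorm p μ c < ∞ := hc
  rw [wNorm, h, ENNReal.top_rpow_of_pos (by positivity)] at h1
  exact lt_irrefl _ h1

lemma summable_of_mem_weightedLp (hp : 0 < p) (hμ : ∀ n : ℕ+, 0 ≤ μ n) {c : ℕ+ → 𝕜}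
    (hc : c ∈ weightedLp 𝕜 p μ) : Summable fun n : ℕ+ => ‖c n‖ ^ p * μ (n : ℝ) ^ p := by
  refine (ENNReal.summable_toReal (tsum_ne_top_of_mem_weightedLp hp hc)).congr fun n => ?_
  exact ENNReal.toReal_ofReal
    (mul_nonneg (Real.rpow_nonneg (norm_nonneg _) _) (Real.rpow_nonneg (hμ n) _))

lemma summable_sq_of_mem_ellTwo {c : ℕ+ → 𝕜} (hc : c ∈ ellTwo 𝕜) :
    Summable fun n : ℕ+ => ‖c n‖ ^ 2 := by
  simpa using summable_of_mem_weightedLp two_pos (fun _ => zero_le_one) hc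

lemma summable_sq_of_mem_weightedLp (hp : 0 < p) (hp2 : p ≤ 2) (hμ1 : ∀ n : ℕ+, 1 ≤ μ n)
    {c : ℕ+ → 𝕜} (hc : c ∈ weightedLp 𝕜 p μ) : Summable fun n : ℕ+ => ‖c n‖ ^ 2 := by
  have h1 := summable_of_mem_weightedLp hp (fun n => zero_le_one.trans (hμ1 n)) hc
  have h2 : Summable fun n : ℕ+ => ‖c n‖ ^ p := by
    refine h1.of_nonneg_of_le (fun n => by positivity) fun n => ?_
    exact le_mul_of_one_le_right (by positivity) (Real.one_le_rpow (hμ1 n) hp.le)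
  refine h2.of_norm_bounded_eventually ?_
  filter_upwards [h2.tendsto_cofinite_zero.eventually_lt_const one_pos] with n hn
  have h3 : ‖c n‖ ≤ 1 := by
    by_contra! h
    exact absurd hn (not_lt.2 (Real.one_le_rpow h.le hp.le))
  rw [Real.norm_of_nonneg (by positivity), ← Real.rpow_natCast]
  exact Real.rpow_le_rpow_of_exponent_ge' (norm_nonneg _) h3 hp.le (by exact_mod_cast hp2)

/-- The tails of a sequence in `ℓ^p_μ` tend to zero. -/
lemma tendsto_wNorm_indicator_compl (hp : 0 < p) {c : ℕ+ → 𝕜} (hc : c ∈ weightedLp 𝕜 p μ) :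
    Filter.Tendsto (fun F : Finset ℕ+ => wNorm p μ (Set.indicator {n | n ∉ F} c))
      Filter.atTop (𝓝 0) := by
  have h1 := ENNReal.tendsto_tsum_compl_atTop_zero (tsum_ne_top_of_mem_weightedLp hp hc)
  have h2 := ((ENNReal.continuous_rpow_const (y := 1 / p)).tendsto 0).comp h1
  rw [ENNReal.zero_rpow_of_pos (by positivity)] at h2
  refine h2.congr fun F => ?_
  simp only [Function.comp_apply, wNorm]
  congr 1
  refine (tsum_subtype {n : ℕ+ | n ∉ F}
    (fun n => ENNReal.ofReal (‖c n‖ ^ p * μ (n : ℝ) ^ p))).trans ?_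
  refine tsum_congr fun n => ?_
  by_cases hn : n ∈ F
  · simp [Set.indicator, hn, Real.zero_rpow hp.ne']
  · simp [Set.indicator, hn]

end SequenceSpaces

section Coorbit

variable {𝕜 H : Type*} [RCLike 𝕜] [NormedAddCommGroup H] [InnerProductSpace 𝕜 H]

lemma norm_sum_sq_le_of_bessel {ι : Type*} {e : ι → H} {B : ℝ} (hB : 0 ≤ B) (F : Finset ι)
    (h : ∀ f, ∑ n ∈ F, ‖inner 𝕜 (e n) f‖ ^ 2 ≤ B * ‖f‖ ^ 2) (c : ι → 𝕜) :
    ‖∑ n ∈ F, c n • e n‖ ^ 2 ≤ B * ∑ n ∈ F, ‖c n‖ ^ 2 := by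
  set v := ∑ n ∈ F, c n • e n with hv
  have hS : 0 ≤ ∑ n ∈ F, ‖c n‖ ^ 2 := Finset.sum_nonneg fun _ _ => by positivity
  have h1 : ‖v‖ ^ 2 ≤ ∑ n ∈ F, ‖c n‖ * ‖inner 𝕜 (e n) v‖ := by
    have h2 : inner 𝕜 v v = ∑ n ∈ F, c n * inner 𝕜 v (e n) := by
      nth_rewrite 2 [hv]
      simp only [inner_sum, inner_smul_right]
    have h3 : ‖v‖ ^ 2 = ‖inner 𝕜 v v‖ := by
      rw [inner_self_eq_norm_sq_to_K]; simp
    rw [h3, h2]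
    refine (norm_sum_le _ _).trans (Finset.sum_le_sum fun n _ => ?_)
    rw [norm_mul, norm_inner_symm]
  have h2 := Finset.sum_mul_sq_le_sq_mul_sq F (fun n => ‖c n‖) (fun n => ‖inner 𝕜 (e n) v‖)
  have h3 : (‖v‖ ^ 2) ^ 2 ≤ (∑ n ∈ F, ‖c n‖ ^ 2) * (B * ‖v‖ ^ 2) :=
    (pow_le_pow_left₀ (by positivity) h1 2).trans
      (h2.trans (mul_le_mul_of_nonneg_left (h v) hS))
  rcases (sq_nonneg ‖v‖).eq_or_lt with h0 | h0
  · rw [← h0]; positivity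
  · nlinarith

/-- The synthesis series of a frame converges unconditionally for square summable sequences. -/
lemma IsFrame.summable_smul [CompleteSpace H] {e : ℕ+ → H} (he : IsFrame 𝕜 e) {c : ℕ+ → 𝕜}
    (hc : Summable fun n => ‖c n‖ ^ 2) : Summable fun n => c n • e n := by
  obtain ⟨A, B, -, hB, h⟩ := he
  rw [summable_iff_vanishing_norm] at hc ⊢
  intro ε hε
  obtain ⟨s, hs⟩ := hc (ε ^ 2 / B) (by positivity)
  refine ⟨s, fun F hF => ?_⟩
  have h1 := hs F hF
  rw [Real.norm_of_nonneg (Finset.sum_nonneg fun _ _ => by positivity), lt_div_iff₀' hB] at h1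
  have h2 := norm_sum_sq_le_of_bessel hB.le F (fun f => ((h f).1.sum_le_tsum F
    (fun _ _ => by positivity)).trans (h f).2.2) c
  exact lt_of_pow_lt_pow_left₀ 2 hε.le (h2.trans_lt h1)

variable {g e : ℕ+ → H} {p β c s C σ K : ℝ} {μ : ℝ → ℝ}

lemma IsRieszBasis.hasSum_inner [CompleteSpace H] (hg : IsRieszBasis 𝕜 g) (x f : H) :
    HasSum (fun k => inner 𝕜 x (g k) * inner 𝕜 (canonicalDual 𝕜 g k) f) (inner 𝕜 x f) := by
  obtain ⟨b, T, T', hT, -, hgT, hgd⟩ := hg.exists_dual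
  have h1 := hasSum_inner_comp b T x (T' f)
  have h2 : T (T' f) = f := DFunLike.congr_fun hT f
  rw [h2] at h1
  simpa only [hgT, hgd, ContinuousLinearMap.adjoint_inner_left] using h1

lemma LocBound.nonneg (h : LocBound 𝕜 g e (fun d => C * decay β c s d)) : 0 ≤ C :=
  nonneg_of_mul_nonneg_left (((norm_nonneg _).trans (le_max_left _ _)).trans (h 1 1))
    (decay_pos (abs_nonneg _))

/-- The analysis operator of a localized sequence is bounded. -/
lemma LocBound.wNorm_analysis_le [CompleteSpace H] (hg : IsRieszBasis 𝕜 g)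
    (he : LocBound 𝕜 g e (fun d => C * decay β c s d)) (hμ : ∀ n : ℕ+, 0 ≤ μ n) (hσ : 1 < σ)
    (hK : 0 ≤ K) (hw : ∀ m n : ℕ+, decay β c s |(m : ℝ) - n| * μ m ≤
      K * (1 + |(m : ℝ) - n|) ^ (-σ) * μ n) (hp : 1 ≤ p) (f : H) :
    wNorm p μ (analysis 𝕜 e f) ≤ ENNReal.ofReal (C * K * decaySum σ) * coNorm 𝕜 p μ g f := by
  have hC := he.nonneg
  refine wNorm_le_of_hasSum hp hσ (mul_nonneg hC hK) hμ (fun n => hg.hasSum_inner (e n) f)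
    fun n m => ?_
  rw [norm_inner_symm]
  calc _ ≤ C * decay β c s |(n : ℝ) - m| * μ n :=
        mul_le_mul_of_nonneg_right ((le_max_left _ _).trans (he n m)) (hμ n)
    _ ≤ C * (K * (1 + |(n : ℝ) - m|) ^ (-σ) * μ m) := by
        rw [mul_assoc]
        exact mul_le_mul_of_nonneg_left (hw n m) hC
    _ = _ := by ring

/-- The synthesis operator of a localized sequence is bounded. -/
lemma LocBound.coNorm_le (he : LocBound 𝕜 g e (fun d => C * decay β c s d))
    (hμ : ∀ n : ℕ+, 0 ≤ μ n) (hσ : 1 < σ) (hK : 0 ≤ K)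
    (hw : ∀ m n : ℕ+, decay β c s |(m : ℝ) - n| * μ m ≤
      K * (1 + |(m : ℝ) - n|) ^ (-σ) * μ n) (hp : 1 ≤ p) {a : ℕ+ → 𝕜} {y : H}
    (hy : HasSum (fun n => a n • e n) y) :
    coNorm 𝕜 p μ g y ≤ ENNReal.ofReal (C * K * decaySum σ) * wNorm p μ a := by
  have hC := he.nonneg
  refine wNorm_le_of_hasSum (M := fun n m => inner 𝕜 (canonicalDual 𝕜 g n) (e m)) hp hσ
    (mul_nonneg hC hK) hμ (fun n => ?_) fun n m => ?_
  · have := hy.mapL (innerSL 𝕜 (canonicalDual 𝕜 g n))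
    simpa [inner_smul_right, analysis, mul_comm] using this
  · calc _ ≤ C * decay β c s |(n : ℝ) - m| * μ n := by
          refine mul_le_mul_of_nonneg_right ?_ (hμ n)
          rw [abs_sub_comm]
          exact (le_max_right _ _).trans (he m n)
      _ ≤ C * (K * (1 + |(n : ℝ) - m|) ^ (-σ) * μ m) := by
          rw [mul_assoc]
          exact mul_le_mul_of_nonneg_left (hw n m) hC
      _ = _ := by ring

/-- Where the synthesis operator is bounded, its series converges unconditionally. -/
lemma hasUncondSum_of_hasSum {L : ℝ≥0∞} (hL : L ≠ ∞) (hp : 0 < p) (hμ : ∀ n : ℕ+, 0 ≤ μ n)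
    (h : ∀ (a : ℕ+ → 𝕜) (y : H), HasSum (fun n => a n • e n) y →
      coNorm 𝕜 p μ g y ≤ L * wNorm p μ a)
    {a : ℕ+ → 𝕜} (ha : a ∈ weightedLp 𝕜 p μ) {y : H} (hy : HasSum (fun n => a n • e n) y) :
    HasUncondSum 𝕜 p μ g (fun n => a n • e n) y := by
  have hfin : ∀ a : ℕ+ → 𝕜, wNorm p μ a < ∞ → L * wNorm p μ a < ∞ := fun a ha =>
    ENNReal.mul_lt_top hL.lt_top ha
  refine ⟨fun n => ?_, (h a y hy).trans_lt (hfin a ha), ?_⟩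
  · have h1 : HasSum (fun m => (Pi.single n (a n) : ℕ+ → 𝕜) m • e m) (a n • e n) := by
      have h2 : HasSum (fun m => (Pi.single n (a n) : ℕ+ → 𝕜) m • e m)
          ((Pi.single n (a n) : ℕ+ → 𝕜) n • e n) := hasSum_single n fun m hm => by simp [hm]
      rwa [Pi.single_eq_same] at h2
    refine (h _ _ h1).trans_lt (hfin _ ((wNorm_mono hp hμ fun m => ?_).trans_lt ha))
    by_cases hm : m = n
    · subst hm; simp
    · simp [hm]
  · have h1 : ∀ F : Finset ℕ+, coNorm 𝕜 p μ g (y - ∑ n ∈ F, a n • e n) ≤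
        L * wNorm p μ (Set.indicator {n | n ∉ F} a) := by
      intro F
      refine h _ _ ?_
      have h2 : HasSum (fun n => (if n ∈ F then a n • e n else 0)) (∑ n ∈ F, a n • e n) := by
        rw [← Finset.sum_congr rfl fun n hn => if_pos hn]
        exact hasSum_sum_of_ne_finset_zero fun n hn => if_neg hn
      refine (hy.sub h2).congr_fun fun n => ?_
      by_cases hn : n ∈ F <;> simp [Set.indicator, hn]
    have h2 := ENNReal.Tendsto.const_mul (tendsto_wNorm_indicator_compl hp ha)
      (Or.inr hL : (0 : ℝ≥0∞) ≠ 0 ∨ L ≠ ∞)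
    rw [mul_zero] at h2
    exact tendsto_of_tendsto_of_tendsto_of_le_of_le tendsto_const_nhds h2 (fun _ => bot_le) h1

lemma ofReal_inv_mul_le {C : ℝ} (hC : 0 < C) {x y : ℝ≥0∞} (h : x ≤ ENNReal.ofReal C * y) :
    ENNReal.ofReal C⁻¹ * x ≤ y := by
  refine (mul_le_mul_right h _).trans_eq ?_
  rw [← mul_assoc, ← ENNReal.ofReal_mul (by positivity), inv_mul_cancel₀ hC.ne',
    ENNReal.ofReal_one, one_mul]

end Coorbit

end LocFrame

end

open LocFrame in
theorem theorem4p3 {𝕜 H : Type*} [RCLike 𝕜] [NormedAddCommGroup H] [InnerProductSpace 𝕜 H]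
    [CompleteSpace H] (g e : ℕ+ → H) (hg : IsRieszBasis 𝕜 g) (he : IsFrame 𝕜 e)
    (t : LocType) (hloc : IsLocalized 𝕜 g e t)
    (μ : ℝ → ℝ) (hμ : IsAdmissibleWeight μ t) (hμ1 : ∀ n : ℕ+, 1 ≤ μ (n : ℝ)) :
    -- the canonical dual frame has the same type of localization
    (IsFrame 𝕜 (canonicalDual 𝕜 e) ∧ IsLocalized 𝕜 g (canonicalDual 𝕜 e) t) ∧
    ∀ p : ℝ, 1 ≤ p →
      -- the analysis operator is bounded
      (∃ C : ℝ, 0 < C ∧ ∀ f ∈ coSpace 𝕜 p μ g,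
        analysis 𝕜 e f ∈ weightedLp 𝕜 p μ ∧
        wNorm p μ (analysis 𝕜 e f) ≤ ENNReal.ofReal C * coNorm 𝕜 p μ g f) ∧
      -- the synthesis operator is bounded
      (∃ C : ℝ, 0 < C ∧ ∀ c ∈ weightedLp 𝕜 p μ, (p ≤ 2 ∨ c ∈ ellTwo 𝕜) →
        Summable (fun n => c n • e n) ∧
        synthesis e c ∈ coSpace 𝕜 p μ g ∧
        coNorm 𝕜 p μ g (synthesis e c) ≤ ENNReal.ofReal C * wNorm p μ c) ∧
      -- the frame operator is invertible, with unconditionally convergent series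
      (Set.BijOn (frameOp 𝕜 e) (coSpace 𝕜 p μ g) (coSpace 𝕜 p μ g) ∧
        (∃ C : ℝ, 0 < C ∧ ∀ f ∈ coSpace 𝕜 p μ g,
          coNorm 𝕜 p μ g (frameOp 𝕜 e f) ≤ ENNReal.ofReal C * coNorm 𝕜 p μ g f ∧
          coNorm 𝕜 p μ g f ≤ ENNReal.ofReal C * coNorm 𝕜 p μ g (frameOp 𝕜 e f)) ∧
        ∀ f ∈ coSpace 𝕜 p μ g,
          HasUncondSum 𝕜 p μ g (fun n => analysis 𝕜 e f n • e n) (frameOp 𝕜 e f)) ∧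
      -- the frame expansions
      (∀ f ∈ coSpace 𝕜 p μ g,
        HasUncondSum 𝕜 p μ g (fun n => analysis 𝕜 e f n • canonicalDual 𝕜 e n) f ∧
        HasUncondSum 𝕜 p μ g (fun n => analysis 𝕜 (canonicalDual 𝕜 e) f n • e n) f) ∧
      -- norm equivalence
      (∃ A B : ℝ, 0 < A ∧ 0 < B ∧ ∀ f ∈ coSpace 𝕜 p μ g,
        ENNReal.ofReal A * coNorm 𝕜 p μ g f ≤ wNorm p μ (analysis 𝕜 e f) ∧
        wNorm p μ (analysis 𝕜 e f) ≤ ENNReal.ofReal B * coNorm 𝕜 p μ g f ∧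
        ENNReal.ofReal A * coNorm 𝕜 p μ g f
          ≤ wNorm p μ (analysis 𝕜 (canonicalDual 𝕜 e) f) ∧
        wNorm p μ (analysis 𝕜 (canonicalDual 𝕜 e) f)
          ≤ ENNReal.ofReal B * coNorm 𝕜 p μ g f) := by
  have hμ0 : ∀ n : ℕ+, 0 ≤ μ n := fun n => zero_le_one.trans (hμ1 n)
  obtain ⟨β, c, s, hβ, hβ1, hc, hs, ⟨C, hC⟩, hspec⟩ := hloc.exists_decay hμ
  obtain ⟨θ, D, hθ, hθ1, hD⟩ := exists_locBound_canonicalDual hg he hβ hβ1 hc hs hC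
  refine ⟨⟨he.isFrame_canonicalDual, (hspec θ hθ hθ1).1 _ D hD⟩, fun p hp => ?_⟩
  have hp0 : 0 < p := by linarith
  obtain ⟨σ₁, K₁, hσ₁, hK₁, hw₁⟩ := (hspec 1 one_pos le_rfl).2
  rw [one_mul] at hw₁
  obtain ⟨σ₂, K₂, hσ₂, hK₂, hw₂⟩ := (hspec θ hθ hθ1).2
  obtain ⟨S, S', hSS', hS'S, hS, hsymm, -, hfo, hd⟩ := he.exists_inverse
  have hSS : ∀ x, S (S' x) = x := fun x => DFunLike.congr_fun hSS' x
  have hSS₂ : ∀ x, S' (S x) = x := fun x => DFunLike.congr_fun hS'S x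
  obtain ⟨L, hL, hL₁, hL₂⟩ : ∃ L : ℝ, 0 < L ∧ C * K₁ * decaySum σ₁ ≤ L ∧
      D * K₂ * decaySum σ₂ ≤ L :=
    ⟨max 1 (max (C * K₁ * decaySum σ₁) (D * K₂ * decaySum σ₂)), lt_max_of_lt_left one_pos,
      (le_max_left _ _).trans (le_max_right _ _), (le_max_right _ _).trans (le_max_right _ _)⟩
  have hLtop : ENNReal.ofReal L ≠ ∞ := ENNReal.ofReal_ne_top
  have he_an : ∀ f, wNorm p μ (analysis 𝕜 e f) ≤ ENNReal.ofReal L * coNorm 𝕜 p μ g f := fun f =>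
    (hC.wNorm_analysis_le hg hμ0 hσ₁ hK₁ hw₁ hp f).trans
      (mul_le_mul_left (ENNReal.ofReal_le_ofReal hL₁) _)
  have hd_an : ∀ f, wNorm p μ (analysis 𝕜 (canonicalDual 𝕜 e) f) ≤
      ENNReal.ofReal L * coNorm 𝕜 p μ g f := fun f =>
    (hD.wNorm_analysis_le hg hμ0 hσ₂ hK₂ hw₂ hp f).trans
      (mul_le_mul_left (ENNReal.ofReal_le_ofReal hL₂) _)
  have he_syn : ∀ (a : ℕ+ → 𝕜) (y : H), HasSum (fun n => a n • e n) y →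
      coNorm 𝕜 p μ g y ≤ ENNReal.ofReal L * wNorm p μ a := fun a y hy =>
    (hC.coNorm_le hμ0 hσ₁ hK₁ hw₁ hp hy).trans (mul_le_mul_left (ENNReal.ofReal_le_ofReal hL₁) _)
  have hd_syn : ∀ (a : ℕ+ → 𝕜) (y : H), HasSum (fun n => a n • canonicalDual 𝕜 e n) y →
      coNorm 𝕜 p μ g y ≤ ENNReal.ofReal L * wNorm p μ a := fun a y hy =>
    (hD.coNorm_le hμ0 hσ₂ hK₂ hw₂ hp hy).trans (mul_le_mul_left (ENNReal.ofReal_le_ofReal hL₂) _)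
  have hd_eq : ∀ f, analysis 𝕜 (canonicalDual 𝕜 e) f = analysis 𝕜 e (S' f) := fun f => by
    funext n
    simp only [analysis, hd, hsymm]
  have hsum_e : ∀ f, HasSum (fun n => analysis 𝕜 e f n • e n) (S f) := hS
  have hsum_ed : ∀ f, HasSum (fun n => analysis 𝕜 e f n • canonicalDual 𝕜 e n) f := fun f => by
    have := (hS f).mapL S'
    simp only [map_smul, hSS₂, ← hd] at this
    exact this
  have hsum_de : ∀ f, HasSum (fun n => analysis 𝕜 (canonicalDual 𝕜 e) f n • e n) f := fun f => by
    have := hsum_e (S' f)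
    rwa [hSS, ← hd_eq] at this
  have hfin : ∀ {x : ℝ≥0∞}, x < ∞ → ENNReal.ofReal L * x < ∞ := fun hx =>
    ENNReal.mul_lt_top hLtop.lt_top hx
  have hSle : ∀ f, coNorm 𝕜 p μ g (S f) ≤ ENNReal.ofReal (L * L) * coNorm 𝕜 p μ g f := fun f => by
    rw [ENNReal.ofReal_mul hL.le, mul_assoc]
    exact (he_syn _ _ (hsum_e f)).trans (mul_le_mul_right (he_an f) _)
  have hS'le : ∀ f, coNorm 𝕜 p μ g (S' f) ≤ ENNReal.ofReal (L * L) * coNorm 𝕜 p μ g f := fun f => by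
    rw [ENNReal.ofReal_mul hL.le, mul_assoc]
    have := hd_syn _ _ (hsum_ed (S' f))
    rw [← hd_eq] at this
    exact this.trans (mul_le_mul_right (hd_an f) _)
  have hLL : ∀ {x : ℝ≥0∞}, x < ∞ → ENNReal.ofReal (L * L) * x < ∞ := fun hx =>
    ENNReal.mul_lt_top ENNReal.ofReal_lt_top hx
  have he_mem : ∀ f ∈ coSpace 𝕜 p μ g, analysis 𝕜 e f ∈ weightedLp 𝕜 p μ := fun f hf =>
    (he_an f).trans_lt (hfin hf)
  have hd_mem : ∀ f ∈ coSpace 𝕜 p μ g,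
      analysis 𝕜 (canonicalDual 𝕜 e) f ∈ weightedLp 𝕜 p μ := fun f hf =>
    (hd_an f).trans_lt (hfin hf)
  refine ⟨⟨L, hL, fun f hf => ⟨he_mem f hf, he_an f⟩⟩, ⟨L, hL, fun a ha hp2 => ?_⟩, ?_,
    fun f hf => ⟨?_, ?_⟩, L⁻¹, L, by positivity, hL, fun f hf => ⟨?_, he_an f, ?_, hd_an f⟩⟩
  · have hsum : Summable fun n => a n • e n := he.summable_smul (hp2.elim
      (fun h => summable_sq_of_mem_weightedLp hp0 h hμ1 ha) summable_sq_of_mem_ellTwo)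
    have hle := he_syn a _ hsum.hasSum
    exact ⟨hsum, hle.trans_lt (hfin ha), hle⟩
  · rw [hfo]
    refine ⟨⟨fun f hf => (hSle f).trans_lt (hLL hf), fun x _ y _ h => ?_, fun y hy =>
      ⟨S' y, (hS'le y).trans_lt (hLL hy), hSS y⟩⟩, ⟨L * L, by positivity, fun f _ =>
      ⟨hSle f, ?_⟩⟩, fun f hf => hasUncondSum_of_hasSum hLtop hp0 hμ0 he_syn (he_mem f hf)
        (hsum_e f)⟩
    · rw [← hSS₂ x, h, hSS₂]
    · have := hS'le (S f)
      rwa [hSS₂] at this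
  · exact hasUncondSum_of_hasSum hLtop hp0 hμ0 hd_syn (he_mem f hf) (hsum_ed f)
  · exact hasUncondSum_of_hasSum hLtop hp0 hμ0 he_syn (hd_mem f hf) (hsum_de f)
  · exact ofReal_inv_mul_le hL (hd_syn _ _ (hsum_ed f))
  · exact ofReal_inv_mul_le hL (he_syn _ _ (hsum_de f))
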